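/- **Conventions.** On $\mathbb P^1(\mathbb C)=\mathbb C\cup\{\infty\}$ let $d(x,y)=\frac{|X\wedge Y|}{\|X\|\,\|Y\|}$ be the spherical (chordal) distance, where $X,Y\in\mathbb C^2\setminus\{0\}$ are homogeneous coordinates of $x,y$ and $\|\cdot\|$ is the Hermitian norm. Let $\omega=\frac{dx\,dy}{\pi(1+|z|^2)^2}$ be the Fubini–Study form, and let $dd^c$ be normalized by $dd^c\log|z|=\delta_0$, i.e. $dd^c=\frac1{2\pi}\Delta\,dx\,dy$. A continuous function $g:\mathbb P^1(\mathbb C)\to\mathbb R$ is a *potential* of a probability measure $\mu$ if $\mu=\omega+dd^cg$ in the sense of distributions. Put $\Phi_g(x,y)=\log d(x,y)-g(x)-g(y)$. The *good potential* of $\mu$ is the potential $g$ normalized by $\iint\Phi_g\,d\mu\,d\mu=0$. For $\alpha\in(0,1]$ let $\|g\|_{C^{0,\alpha}}=\sup_{x\ne y}\frac{|g(x)-g(y)|}{d(x,y)^\alpha}$; $g$ is $\alpha$-Hölder if $|g(x)-g(y)|\le C\,d(x,y)^\alpha$ for some constant $C$ and all $x,y$. For $\varphi\in W^{1,2}(\mathbb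 P^1(\mathbb C),\mathbb R)$ let $\|\nabla\varphi\|_{L^2}=\left(\int d\varphi\wedge d^c\varphi\right)^{1/2}=\left(\frac1{2\pi}\int_{\mathbb C}|\nabla\varphi|^2\,dx\,dy\right)^{1/2}$, and for continuous $\varphi$ let $\eta_\varphi(\delta)=\sup\{|\varphi(x)-\varphi(y)|:\ d(x,y)\le\delta\}$ be its modulus of continuity. **Proposition.** Let $\alpha\in(0,1]$ and let $\mu$ be a probability measure on $\mathbb P^1(\mathbb C)$ whose good potential $g$ is $\alpha$-Hölder. Let $F\subset\mathbb P^1(\mathbb C)$ be a finite set of cardinality $n\ge2$ and put $$A=-\frac1{n(n-1)}\sum_{x\ne y\in F}\Phi_g(x,y)+\frac{2\|g\|_{C^{0,\alpha}}\max(1,\log n)+\left(2+\max\left(2,\tfrac1\alpha\right)\right)\log n}{n},$$ the sum being over ordered pairs of distinct points; for $n\ge3$ the second term is simply $\left(2\|g\|_{C^{0,\alpha}}+2+\max\left(2,\tfrac1\alpha\right)\right)\frac{\log n}{n}$. Then $A\ge0$, and for every continuous $\varphi\in W^{1,2}(\mathbb P^1(\mathbb C),\mathbb R)$, $$\left|\int_{\mathbb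 P^1(\mathbb C)}\varphi\,d\mu-\frac1n\sum_{z\in F}\varphi(z)\right|\le\eta_\varphi\!\left(\frac1{n^{\max(2,1/\alpha)}}\right)+A^{1/2}\,\|\nabla\varphi\|_{L^2}.$$ -/

import Mathlib

open MeasureTheory
open scoped ContDiff

noncomputable section

namespace RiemannSphere

/-- The complex projective line `ℙ¹(ℂ) = ℂ ∪ {∞}`, with `z = [z : 1]` and `∞ = [1 : 0]`;
as a topological space it is the one-point compactification of `ℂ`. -/
abbrev P1 : Type := OnePoint ℂ

/-- The Borel `σ`-algebra of the projective line. -/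
instance instMeasurableSpaceP1 : MeasurableSpace (OnePoint ℂ) := borel _

instance instBorelSpaceP1 : BorelSpace (OnePoint ℂ) := ⟨rfl⟩

/-- Homogeneous coordinates: `z ↦ (z, 1)`, `∞ ↦ (1, 0)`. -/
def homCoord (x : P1) : ℂ × ℂ := x.elim (1, 0) (fun z => (z, 1))

/-- The (chordal) spherical distance `|X ∧ Y| / (‖X‖ ‖Y‖)`, where `X`, `Y` are homogeneous
coordinates of `x`, `y` and `‖·‖` is the Hermitian norm of `ℂ²`. -/
def sphDist (x y : P1) : ℝ :=
  ‖(homCoord x).1 * (homCoord y).2 - (homCoord x).2 * (homCoord y).1‖ /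
    (√(‖(homCoord x).1‖ ^ 2 + ‖(homCoord x).2‖ ^ 2) *
      √(‖(homCoord y).1‖ ^ 2 + ‖(homCoord y).2‖ ^ 2))

/-- The affine chart `z ↦ [z : 1]`. -/
def chartZero (z : ℂ) : P1 := (z : OnePoint ℂ)

/-- The affine chart at infinity `w ↦ [1 : w]`. -/
def chartInfty (w : ℂ) : P1 := if w = 0 then OnePoint.infty else ((w⁻¹ : ℂ) : OnePoint ℂ)

/-- The Fubini-Study form `ω`, seen as a probability measure: in the affine coordinate `z = x + iy`
it is `dx dy / (π (1 + |z|²)²)`, and it does not charge `∞`. -/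
def fubiniStudy : Measure P1 :=
  ((volume : Measure ℂ).withDensity
    (fun z => ENNReal.ofReal (1 / (Real.pi * (1 + ‖z‖ ^ 2) ^ 2)))).map chartZero

/-- Real-valued functions on `ℙ¹(ℂ)` that are `C^∞` (as functions of two real variables). -/
def IsSmooth (ψ : P1 → ℝ) : Prop :=
  ContDiff ℝ ∞ (ψ ∘ chartZero) ∧ ContDiff ℝ ∞ (ψ ∘ chartInfty)

/-- The continuous function `g` is a potential of `μ`, i.e. `μ = ω + dd^c g` in the sense of
distributions on `ℙ¹(ℂ)`. Here `dd^c` is normalised by `dd^c log |z| = δ_0`, so that for a smooth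
test function `ψ` one has `dd^c ψ = (1 / 2π) (Δ ψ) dx dy` in the affine coordinate. -/
def IsPotential (μ : Measure P1) (g : P1 → ℝ) : Prop :=
  Continuous g ∧ ∀ ψ : P1 → ℝ, IsSmooth ψ →
    ∫ x, ψ x ∂μ = ∫ x, ψ x ∂fubiniStudy +
      (2 * Real.pi)⁻¹ * ∫ z : ℂ, g (chartZero z) * Laplacian.laplacian (ψ ∘ chartZero) z

/-- The kernel `Φ_g(x, y) = log d(x, y) - g(x) - g(y)`. It is only used off the diagonal (where it
is real), or up to sets of measure zero for `μ ⊗ μ` with `μ` without atoms; on the diagonal, where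
the kernel is `-∞`, the value given here carries no meaning. -/
def hsiaKernel (g : P1 → ℝ) (x y : P1) : ℝ := Real.log (sphDist x y) - g x - g y

/-- The good potential of `μ`: the potential `g` of `μ` with `∬ Φ_g dμ dμ = 0`. -/
def IsGoodPotential (μ : Measure P1) (g : P1 → ℝ) : Prop :=
  IsPotential μ g ∧
    Integrable (fun p : P1 × P1 => hsiaKernel g p.1 p.2) (μ.prod μ) ∧
    ∫ p : P1 × P1, hsiaKernel g p.1 p.2 ∂(μ.prod μ) = 0

/-- `g` is `α`-Hölder continuous for the spherical distance. -/
def IsHolder (α : ℝ) (g : P1 → ℝ) : Prop :=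
  ∃ C : ℝ, 0 < C ∧ ∀ x y : P1, |g x - g y| ≤ C * sphDist x y ^ α

/-- The Hölder semi-norm `sup_{x ≠ y} |g(x) - g(y)| / d(x, y)^α`. -/
def holderSeminorm (α : ℝ) (g : P1 → ℝ) : ℝ :=
  sSup {r : ℝ | ∃ x y : P1, x ≠ y ∧ r = |g x - g y| / sphDist x y ^ α}

/-- The modulus of continuity `η_φ(δ) = sup {|φ(x) - φ(y)| : d(x, y) ≤ δ}`. -/
def modulus (φ : P1 → ℝ) (δ : ℝ) : ℝ :=
  sSup {r : ℝ | ∃ x y : P1, sphDist x y ≤ δ ∧ r = |φ x - φ y|}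

/-- `G = ∂u/∂x + i ∂u/∂y` is the weak gradient of `u` on `ℂ = ℝ²`. -/
def IsWeakGradient (u : ℂ → ℝ) (G : ℂ → ℂ) : Prop :=
  LocallyIntegrable u ∧ LocallyIntegrable G ∧
    ∀ ψ : ℂ → ℝ, ContDiff ℝ ∞ ψ → HasCompactSupport ψ → ∀ v : ℂ,
      ∫ z, u z * fderiv ℝ ψ z v = -∫ z, inner ℝ (G z) v * ψ z

/-- `u` has a square integrable weak gradient on `ℂ`. -/
def HasL2Gradient (u : ℂ → ℝ) : Prop :=
  ∃ G : ℂ → ℂ, MemLp G 2 ∧ IsWeakGradient u G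

/-- The Sobolev space `W^{1,2}(ℙ¹(ℂ), ℝ)`: square integrable functions with square integrable weak
gradient. The square integrability of a gradient does not depend on the conformal metric used to
measure it, whence the Euclidean metric in each of the two affine charts. -/
def MemW12 (φ : P1 → ℝ) : Prop :=
  MemLp φ 2 fubiniStudy ∧ HasL2Gradient (φ ∘ chartZero) ∧ HasL2Gradient (φ ∘ chartInfty)

open scoped Classical in
/-- A square integrable weak gradient of `u` (it is unique almost everywhere), if there is one. -/
def weakGradient (u : ℂ → ℝ) : ℂ → ℂ :=
  if h : HasL2Gradient u then h.choose else 0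

/-- The Dirichlet semi-norm `‖∇φ‖_{L²} = (∫ dφ ∧ d^c φ)^{1/2}`, which in the affine coordinate and
with the normalisation `dd^c log |z| = δ_0` is `((1 / 2π) ∫ |∇φ|² dx dy)^{1/2}`. -/
def gradNorm (φ : P1 → ℝ) : ℝ :=
  √((2 * Real.pi)⁻¹ * ∫ z : ℂ, ‖weakGradient (φ ∘ chartZero) z‖ ^ 2)

open scoped Classical in
/-- The constant `A`, with `n = #F`:
`-(1 / (n (n - 1))) ∑_{x ≠ y ∈ F} Φ_g(x, y)
  + (2 ‖g‖_{C^{0,α}} max(1, log n) + (2 + max(2, 1/α)) log n) / n`.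
For `n ≥ 3` one has `max(1, log n) = log n`. -/
def constA (α : ℝ) (g : P1 → ℝ) (F : Finset P1) : ℝ :=
  -(1 / ((F.card : ℝ) * ((F.card : ℝ) - 1))) * (∑ p ∈ F.offDiag, hsiaKernel g p.1 p.2) +
    (2 * holderSeminorm α g * max 1 (Real.log F.card) +
      (2 + max 2 (1 / α)) * Real.log F.card) / F.card

end RiemannSphere

end

noncomputable section

namespace RiemannSphere

/-! The empirical measure of `F` has infinite energy, so each point mass at `z` is replaced by a
smooth probability measure `regDirac δ z`, radial about `z` and carried by the annulus δ/4 ≤ d² ≤ δ.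
Its potential is `regLog δ (chordSq z ·)`, a regularised logarithm of the distance. Let ν be the
average of these measures over `F`, U its potential and h = U - g. Then Δh = 2π(ν - μ), and formally
E = ∫ h dμ - ∫ h dν is the Dirichlet energy of h. Hence E ≥ 0, and Cauchy-Schwarz gives |∫ φ dμ - ∫
φ dν| ≤ √E ‖∇φ‖. This is `energy_estimate`. It is proved in the affine plane by mollifying h and
using cutoffs whose energy tends to 0, since the point at infinity has capacity zero. Replacing ν by
the true empirical measure costs at most the modulus of continuity of φ at √δ.

It remains to show E ≤ A (`energy_le`). By `IsGoodPotential.integral_eq` the normalisation of g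
reads ∫ g dμ = -1/2 - ∫ g dω, so the ω-terms cancel, leaving 2 ∫ g dν minus the mutual energy of the
smoothed masses, up to an error δ. Off-diagonal terms of that energy are at least log d(z, w) - δ
(`log_sphDist_le_integral_regLog`). Each of the n diagonal terms is at least (1/2) log δ - log 2
(`log_le_integral_regLog_self`). With √δ = n ^ (-max(2, 1/α)) the Hölder error is at most ‖g‖/n, the
diagonal costs max(2, 1/α) (log n)/n + (log 2)/n, and what is left fits into (log n)/n.

The explicit formulas rest on a one-variable reduction. The Laplacian of f(d(z, ·)²) relative to ω
is the operator `chordLap` applied to f, and d(z, ·)² is uniformly distributed on [0, 1] under ω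
(`integral_comp_chordSq`). -/

/-! ### Weak gradients and integration by parts in the plane. -/

/-- The gradient `∂u/∂x + i ∂u/∂y` of a function on the plane. -/
def pgrad (u : ℂ → ℝ) (z : ℂ) : ℂ := ⟨fderiv ℝ u z 1, fderiv ℝ u z Complex.I⟩

lemma inner_eq_re_add_im (a b : ℂ) : inner ℝ a b = a.re * b.re + a.im * b.im := by
  rw [Complex.inner]; simp [Complex.mul_re]; ring

lemma contDiff_fderiv_apply {u : ℂ → ℝ} (hu : ContDiff ℝ ∞ u) (v : ℂ) :
    ContDiff ℝ ∞ (fun z => fderiv ℝ u z v) :=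
  (hu.fderiv_right (m := ∞) (by simp)).clm_apply contDiff_const

lemma continuous_pgrad {u : ℂ → ℝ} (hu : ContDiff ℝ ∞ u) : Continuous (pgrad u) := by
  have h1 := (contDiff_fderiv_apply hu 1).continuous
  have h2 := (contDiff_fderiv_apply hu Complex.I).continuous
  have : pgrad u = fun z => (fderiv ℝ u z 1 : ℂ) + (fderiv ℝ u z Complex.I : ℂ) * Complex.I := by
    ext z; apply Complex.ext <;> simp [pgrad]
  rw [this]
  fun_prop

lemma laplacian_eq {u : ℂ → ℝ} (hu : ContDiff ℝ ∞ u) (z : ℂ) :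
    Laplacian.laplacian u z = fderiv ℝ (fun w => fderiv ℝ u w 1) z 1 +
      fderiv ℝ (fun w => fderiv ℝ u w Complex.I) z Complex.I := by
  rw [InnerProductSpace.laplacian_eq_iteratedFDeriv_complexPlane]
  have hd : DifferentiableAt ℝ (fderiv ℝ u) z :=
    ((hu.fderiv_right (m := ∞) (by simp)).differentiable (by simp)) z
  simp only [iteratedFDeriv_two_apply]
  rw [fderiv_clm_apply hd (differentiableAt_const _), fderiv_clm_apply hd (differentiableAt_const _)]
  simp

lemma continuous_laplacian {u : ℂ → ℝ} (hu : ContDiff ℝ ∞ u) :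
    Continuous (Laplacian.laplacian u) := by
  rw [show Laplacian.laplacian u = _ from funext (laplacian_eq hu)]
  exact (contDiff_fderiv_apply (contDiff_fderiv_apply hu 1) 1).continuous.add
    (contDiff_fderiv_apply (contDiff_fderiv_apply hu _) _).continuous

lemma pgrad_mul {u v : ℂ → ℝ} {z : ℂ} (hu : DifferentiableAt ℝ u z) (hv : DifferentiableAt ℝ v z) :
    pgrad (fun w => u w * v w) z = u z • pgrad v z + v z • pgrad u z := by
  unfold pgrad
  rw [fderiv_fun_mul hu hv]
  apply Complex.ext <;> simp

lemma hasCompactSupport_pgrad {u : ℂ → ℝ} (hu : HasCompactSupport u) :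
    HasCompactSupport (pgrad u) := by
  refine (hu.fderiv (𝕜 := ℝ)).mono' ?_
  intro z hz
  apply subset_tsupport
  intro h0
  apply hz
  simp [pgrad, h0]
  rfl

/-- Testing the weak gradient of `φ` against the field `η ∇H`. -/
lemma IsWeakGradient.integral_mul_laplacian {φ : ℂ → ℝ} {G : ℂ → ℂ} (hG : IsWeakGradient φ G)
    {H η : ℂ → ℝ} (hH : ContDiff ℝ ∞ H) (hη : ContDiff ℝ ∞ η) (hηc : HasCompactSupport η) :
    ∫ z, φ z * (η z * Laplacian.laplacian H z) =
      -(∫ z, η z * inner ℝ (G z) (pgrad H z)) - ∫ z, φ z * inner ℝ (pgrad η z) (pgrad H z) := by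
  obtain ⟨hφl, hGl, hw⟩ := hG
  have hH1 := contDiff_fderiv_apply hH 1
  have hH2 := contDiff_fderiv_apply hH Complex.I
  -- The two components of η ∇H are tested in the directions 1 and I; the sum of the two identities
  -- contains div(η ∇H) = η ΔH + ∇η · ∇H.
  have e1 := hw (fun z => η z * fderiv ℝ H z 1) (hη.mul hH1) hηc.mul_right 1
  have e2 := hw (fun z => η z * fderiv ℝ H z Complex.I) (hη.mul hH2) hηc.mul_right Complex.I
  have dη : Differentiable ℝ η := hη.differentiable (by simp)
  have d1 : Differentiable ℝ (fun z => fderiv ℝ H z 1) := hH1.differentiable (by simp)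
  have d2 : Differentiable ℝ (fun z => fderiv ℝ H z Complex.I) := hH2.differentiable (by simp)
  have key : ∀ f : ℂ → ℝ, Continuous f → HasCompactSupport f → Integrable (fun z => φ z * f z) :=
    fun f hf hfc => hφl.integrable_smul_right_of_hasCompactSupport hf hfc
  have keyG : ∀ f : ℂ → ℝ, Continuous f → HasCompactSupport f → ∀ v : ℂ,
      Integrable (fun z => inner ℝ (G z) v * f z) := by
    intro f hf hfc v
    have := (hGl.integrable_smul_left_of_hasCompactSupport hf hfc).inner_const (𝕜 := ℝ) v
    refine this.congr (.of_forall fun z => ?_)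
    simp only [inner_eq_re_add_im, Complex.real_smul, Complex.re_ofReal_mul, Complex.im_ofReal_mul]
    ring
  have i1 := key _ (contDiff_fderiv_apply (hη.mul hH1) 1).continuous
    ((hηc.mul_right (f' := fun z => fderiv ℝ H z 1)).fderiv_apply (𝕜 := ℝ) 1)
  have i2 := key _ (contDiff_fderiv_apply (hη.mul hH2) Complex.I).continuous
    ((hηc.mul_right (f' := fun z => fderiv ℝ H z Complex.I)).fderiv_apply (𝕜 := ℝ) Complex.I)
  have j1 := keyG _ (hη.mul hH1).continuous hηc.mul_right 1
  have j2 := keyG _ (hη.mul hH2).continuous hηc.mul_right Complex.I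
  have ci : Continuous fun z => inner ℝ (pgrad η z) (pgrad H z) :=
    (continuous_pgrad hη).inner (continuous_pgrad hH)
  have k1 : Integrable (fun z => φ z * inner ℝ (pgrad η z) (pgrad H z)) := by
    apply key _ ci
    refine (hasCompactSupport_pgrad hηc).mono fun z hz => ?_
    contrapose! hz
    simp only [Function.mem_support, not_not] at hz ⊢
    simp [hz]
  have k2 : Integrable (fun z => φ z * (η z * Laplacian.laplacian H z)) :=
    key _ (hη.continuous.mul (continuous_laplacian hH)) hηc.mul_right
  have lhs : (∫ z, φ z * fderiv ℝ (fun z => η z * fderiv ℝ H z 1) z 1) +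
      (∫ z, φ z * fderiv ℝ (fun z => η z * fderiv ℝ H z Complex.I) z Complex.I) =
      (∫ z, φ z * (η z * Laplacian.laplacian H z)) +
        ∫ z, φ z * inner ℝ (pgrad η z) (pgrad H z) := by
    rw [← integral_add i1 i2, ← integral_add k2 k1]
    congr 1; ext z
    rw [fderiv_fun_mul (dη z) (d1 z), fderiv_fun_mul (dη z) (d2 z), laplacian_eq hH, inner_eq_re_add_im]
    simp only [add_apply, smul_apply, smul_eq_mul, pgrad]
    ring
  have rhs : (∫ z, inner ℝ (G z) 1 * (η z * fderiv ℝ H z 1)) +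
      (∫ z, inner ℝ (G z) Complex.I * (η z * fderiv ℝ H z Complex.I)) =
      ∫ z, η z * inner ℝ (G z) (pgrad H z) := by
    rw [← integral_add j1 j2]
    congr 1; ext z
    simp only [inner_eq_re_add_im, pgrad, Complex.one_re, Complex.one_im, Complex.I_re, Complex.I_im]
    ring
  linarith

lemma isWeakGradient_pgrad {u : ℂ → ℝ} (hu : ContDiff ℝ ∞ u) : IsWeakGradient u (pgrad u) := by
  refine ⟨hu.continuous.locallyIntegrable, (continuous_pgrad hu).locallyIntegrable, ?_⟩
  intro ψ hψ hψc v
  have hv : ∀ z, inner ℝ (pgrad u z) v = fderiv ℝ u z v := by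
    intro z
    have : v = v.re • (1 : ℂ) + v.im • Complex.I := by
      apply Complex.ext <;> simp
    conv_rhs => rw [this, map_add, map_smul, map_smul]
    rw [inner_eq_re_add_im]; simp [pgrad]; ring
  simp only [hv]
  have c1 := (contDiff_fderiv_apply hu v).continuous
  have c2 := (contDiff_fderiv_apply hψ v).continuous
  have hfv : HasCompactSupport (fun z => fderiv ℝ ψ z v) := hψc.fderiv_apply (𝕜 := ℝ) v
  apply integral_mul_fderiv_eq_neg_fderiv_mul_of_integrable
  · exact (c1.mul hψ.continuous).integrable_of_hasCompactSupport hψc.mul_left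
  · exact (hu.continuous.mul c2).integrable_of_hasCompactSupport hfv.mul_left
  · exact (hu.continuous.mul hψ.continuous).integrable_of_hasCompactSupport hψc.mul_left
  · exact fun x _ => hu.differentiable (by simp) x
  · exact fun x _ => hψ.differentiable (by simp) x

/-- The Cauchy-Schwarz inequality for integrals. -/
lemma abs_integral_le_sqrt_mul_sqrt {X : Type*} [MeasurableSpace X] {m : Measure X}
    {k a b : X → ℝ} (ha : MemLp a 2 m) (hb : MemLp b 2 m) (hk : ∀ x, |k x| ≤ |a x| * |b x|) :
    |∫ x, k x ∂m| ≤ √(∫ x, a x ^ 2 ∂m) * √(∫ x, b x ^ 2 ∂m) := by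
  have hab : Integrable (fun x => |a x| * |b x|) m := by
    have := (ha.norm).integrable_mul (hb.norm)
    simpa [Pi.mul_def] using this
  calc |∫ x, k x ∂m| ≤ ∫ x, |k x| ∂m := abs_integral_le_integral_abs
    _ ≤ ∫ x, |a x| * |b x| ∂m :=
        integral_mono_of_nonneg (.of_forall fun x => abs_nonneg _) hab (.of_forall hk)
    _ ≤ (∫ x, |a x| ^ (2:ℝ) ∂m) ^ (1 / (2:ℝ)) * (∫ x, |b x| ^ (2:ℝ) ∂m) ^ (1 / (2:ℝ)) := by
        apply integral_mul_le_Lp_mul_Lq_of_nonneg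
          (Real.HolderConjugate.two_two)
        · exact .of_forall fun x => abs_nonneg _
        · exact .of_forall fun x => abs_nonneg _
        · simpa using ha.norm
        · simpa using hb.norm
    _ = _ := by
        rw [← Real.sqrt_eq_rpow, ← Real.sqrt_eq_rpow]
        norm_num

/-! ### Cutoffs of vanishing energy at infinity, and Green's formula. -/

lemma pgrad_comp_norm_sq {q : ℝ → ℝ} {q' : ℝ} {z : ℂ} (hq : HasDerivAt q q' (‖z‖ ^ 2)) :
    pgrad (fun w => q (‖w‖ ^ 2)) z = (2 * q' : ℝ) • z := by
  have h1 : HasFDerivAt (fun w : ℂ => ‖w‖ ^ 2) (2 • (innerSL ℝ z)) z :=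
    (hasStrictFDerivAt_norm_sq z).hasFDerivAt
  have h2 := hq.comp_hasFDerivAt z h1
  have h3 : fderiv ℝ (fun w : ℂ => q (‖w‖ ^ 2)) z = q' • (2 • (innerSL ℝ z)) := h2.fderiv
  unfold pgrad
  rw [h3]
  apply Complex.ext <;> simp <;> ring

lemma exists_abs_deriv_smoothTransition_le : ∃ C : ℝ, ∀ t, |deriv Real.smoothTransition t| ≤ C := by
  have hc : Continuous (deriv Real.smoothTransition) :=
    (Real.smoothTransition.contDiff (n := ⊤)).continuous_deriv (by simp)
  have hs : HasCompactSupport (deriv Real.smoothTransition) := by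
    refine HasCompactSupport.intro (isCompact_Icc (a := (0 : ℝ)) (b := 1)) fun t ht => ?_
    rw [Set.mem_Icc, not_and_or, not_le, not_le] at ht
    rcases ht with ht | ht
    · have : Real.smoothTransition =ᶠ[nhds t] fun _ => 0 := by
        filter_upwards [gt_mem_nhds ht] with s hs
        exact Real.smoothTransition.zero_of_nonpos hs.le
      rw [this.deriv_eq]; simp
    · have : Real.smoothTransition =ᶠ[nhds t] fun _ => 1 := by
        filter_upwards [lt_mem_nhds ht] with s hs
        exact Real.smoothTransition.one_of_one_le hs.le
      rw [this.deriv_eq]; simp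
  obtain ⟨C, hC⟩ := hs.exists_bound_of_continuous hc
  exact ⟨C, fun t => by simpa using hC t⟩

/-- Up to a factor 4 the integrand is the squared gradient of log(1 + log(1 + |z|²)). In polar
coordinates it is dominated by the derivative of -1/(1 + log(1 + r²)), which has a finite limit at
infinity. -/
lemma integrable_log_cutoff_weight :
    Integrable (fun z : ℂ => ‖z‖ ^ 2 / ((1 + ‖z‖ ^ 2) * (1 + Real.log (1 + ‖z‖ ^ 2))) ^ 2) := by
  have key : IntegrableOn (fun r : ℝ => 2 * r / ((1 + r ^ 2) * (1 + Real.log (1 + r ^ 2)) ^ 2))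
      (Set.Ioi 0) := by
    have hl : ∀ r : ℝ, 0 ≤ Real.log (1 + r ^ 2) := fun r =>
      Real.log_nonneg (by nlinarith [sq_nonneg r])
    refine integrableOn_Ioi_deriv_of_nonneg' (g := fun r => -(1 + Real.log (1 + r ^ 2))⁻¹)
      (l := 0) (fun r _ => ?_) (fun r hr => ?_) ?_
    · have h0 : HasDerivAt (fun r : ℝ => 1 + r ^ 2) (2 * r) r := by
        simpa using (hasDerivAt_pow 2 r).const_add 1
      have h1 := (h0.log (by positivity)).const_add 1
      have h2 := (h1.inv (by linarith [hl r])).neg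
      exact h2.congr_deriv (by rw [neg_div, neg_neg, div_div])
    · have := hl r
      have : 0 < r := hr
      positivity
    · rw [← neg_zero]
      refine Filter.Tendsto.neg (Filter.Tendsto.inv_tendsto_atTop ?_)
      refine Filter.tendsto_atTop_add_const_left _ _ (Real.tendsto_log_atTop.comp ?_)
      exact Filter.tendsto_atTop_add_const_left _ _ (Filter.tendsto_pow_atTop (by norm_num))
  have := (integrable_fun_norm_addHaar (E := ℂ) volume
    (f := fun r : ℝ => r ^ 2 / ((1 + r ^ 2) * (1 + Real.log (1 + r ^ 2))) ^ 2)).2 ?_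
  · exact this
  · refine Integrable.mono' key ?_ ?_
    · refine Measurable.aestronglyMeasurable ?_
      fun_prop
    · refine (ae_restrict_iff' measurableSet_Ioi).2 (.of_forall fun r hr => ?_)
      have hr : 0 < r := hr
      have hl : 0 ≤ Real.log (1 + r ^ 2) := Real.log_nonneg (by nlinarith [sq_nonneg r])
      simp only [Complex.finrank_real_complex, smul_eq_mul, Real.norm_eq_abs]
      rw [abs_of_nonneg (by positivity), ← mul_div_assoc, div_le_div_iff₀ (by positivity) (by positivity)]
      have : r ^ (2-1) * r ^ 2 ≤ 2 * r * (1 + r ^ 2) := by norm_num; nlinarith [pow_pos hr 3]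
      calc _ ≤ (2 * r * (1 + r ^ 2)) * ((1 + r ^ 2) * (1 + Real.log (1 + r ^ 2)) ^ 2) := by gcongr
        _ = _ := by ring

/-- The point at infinity has capacity zero: there are compactly supported smooth cutoffs tending
to `1` with Dirichlet energy tending to `0`. -/
lemma exists_cutoff : ∃ χ : ℕ → ℂ → ℝ, (∀ N, ContDiff ℝ ∞ (χ N)) ∧
    (∀ N, HasCompactSupport (χ N)) ∧ (∀ N z, 0 ≤ χ N z) ∧ (∀ N z, χ N z ≤ 1) ∧
    (∀ z, Filter.Tendsto (fun N => χ N z) Filter.atTop (nhds 1)) ∧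
    Filter.Tendsto (fun N => √(∫ z, ‖pgrad (χ N) z‖ ^ 2)) Filter.atTop (nhds 0) := by
  obtain ⟨C, hC⟩ := exists_abs_deriv_smoothTransition_le
  have hl : ∀ t : ℝ, 0 ≤ t → 0 ≤ Real.log (1 + t) := fun t ht => Real.log_nonneg (by linarith)
  -- The cutoff is 1 where log(1 + log(1 + t)) ≤ N + 1 and 0 where it is at least 2(N + 1). The
  -- doubly logarithmic scale makes the L² norm of its gradient O(1/(N + 1)).
  set q : ℕ → ℝ → ℝ := fun N t =>
    Real.smoothTransition (2 - Real.log (1 + Real.log (1 + t)) / (N + 1)) with hq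
  have hqd : ∀ N t, 0 ≤ t → HasDerivAt (q N)
      (deriv Real.smoothTransition (2 - Real.log (1 + Real.log (1 + t)) / (N + 1)) *
        (-(1 / (1 + t) / (1 + Real.log (1 + t)) / (N + 1)))) t := by
    intro N t ht
    have h0 : HasDerivAt (fun t : ℝ => 1 + t) 1 t := (hasDerivAt_id t).const_add 1
    have h1 := (h0.log (by positivity)).const_add 1
    have h2 := (h1.log (by linarith [hl t ht])).div_const ((N : ℝ) + 1)
    have h3 := h2.const_sub 2
    have h4 := ((Real.smoothTransition.contDiff (n := ⊤)).differentiable (by simp)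
      (2 - Real.log (1 + Real.log (1 + t)) / (N + 1))).hasDerivAt
    exact h4.comp t h3
  have hN : ∀ N : ℕ, (0 : ℝ) < N + 1 := fun N => by positivity
  refine ⟨fun N z => q N (‖z‖ ^ 2), fun N => ?_, fun N => ?_, fun N z =>
    Real.smoothTransition.nonneg _, fun N z => Real.smoothTransition.le_one _, fun z => ?_, ?_⟩
  · refine (Real.smoothTransition.contDiff (n := ⊤)).comp (contDiff_const.sub (ContDiff.div_const ?_ _))
    refine ContDiff.log (contDiff_const.add (ContDiff.log (contDiff_const.add
      (contDiff_norm_sq ℝ)) fun z => by positivity)) fun z => ?_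
    have := hl (‖z‖ ^ 2) (by positivity)
    positivity
  · refine HasCompactSupport.intro
      (isCompact_closedBall (0 : ℂ) (Real.exp (Real.exp (2 * (N + 1))))) fun z hz => ?_
    rw [mem_closedBall_zero_iff, not_le] at hz
    apply Real.smoothTransition.zero_of_nonpos
    rw [sub_nonpos, le_div_iff₀ (hN N)]
    have h1 : Real.exp (2 * (N + 1)) ≤ Real.log ‖z‖ := by
      rw [Real.le_log_iff_exp_le ((Real.exp_pos _).trans hz)]; exact hz.le
    have h2 : Real.log ‖z‖ ≤ Real.log (1 + ‖z‖ ^ 2) := by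
      apply Real.log_le_log ((Real.exp_pos _).trans hz)
      nlinarith [sq_nonneg (‖z‖ - 1)]
    rw [Real.le_log_iff_exp_le (by linarith [hl (‖z‖ ^ 2) (by positivity)])]
    linarith
  · refine tendsto_const_nhds.congr' ?_
    filter_upwards [Filter.eventually_ge_atTop ⌈Real.log (1 + Real.log (1 + ‖z‖ ^ 2))⌉₊] with N hle
    symm
    apply Real.smoothTransition.one_of_one_le
    have h1 : Real.log (1 + Real.log (1 + ‖z‖ ^ 2)) ≤ N := (Nat.le_ceil _).trans (by exact_mod_cast hle)
    have : Real.log (1 + Real.log (1 + ‖z‖ ^ 2)) / (N + 1) ≤ 1 := by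
      rw [div_le_one (hN N)]; linarith
    linarith
  · set w : ℂ → ℝ := fun z => ‖z‖ ^ 2 / ((1 + ‖z‖ ^ 2) * (1 + Real.log (1 + ‖z‖ ^ 2))) ^ 2 with hw
    have hle : ∀ (N : ℕ) (z : ℂ), ‖pgrad (fun z => q N (‖z‖ ^ 2)) z‖ ^ 2 ≤
        (1 / ((N : ℝ) + 1)) ^ 2 * (4 * C ^ 2 * w z) := by
      intro N z
      have h1 := hl (‖z‖ ^ 2) (by positivity)
      rw [pgrad_comp_norm_sq (hqd N (‖z‖ ^ 2) (by positivity)), norm_smul, mul_pow, Real.norm_eq_abs,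
        sq_abs]
      have h2 := sq_le_sq' (abs_le.1 (hC (2 - Real.log (1 + Real.log (1 + ‖z‖ ^ 2)) / (N + 1)))).1
        (abs_le.1 (hC (2 - Real.log (1 + Real.log (1 + ‖z‖ ^ 2)) / (N + 1)))).2
      have e : (1 / ((N : ℝ) + 1)) ^ 2 * (4 * C ^ 2 * w z) =
          C ^ 2 * (4 * (1 / ((N : ℝ) + 1)) ^ 2 * w z) := by ring
      rw [e]
      calc _ = (deriv Real.smoothTransition
              (2 - Real.log (1 + Real.log (1 + ‖z‖ ^ 2)) / (N + 1))) ^ 2 *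
              (4 * (1 / ((N : ℝ) + 1)) ^ 2 * w z) := by
            simp only [hw]
            field_simp
            ring
        _ ≤ _ := by
            have : 0 ≤ w z := by positivity
            gcongr
    have hb : ∀ N : ℕ, √(∫ z, ‖pgrad (fun z => q N (‖z‖ ^ 2)) z‖ ^ 2) ≤
        1 / ((N : ℝ) + 1) * √(∫ z, 4 * C ^ 2 * w z) := by
      intro N
      rw [← Real.sqrt_sq (show 0 ≤ 1 / ((N : ℝ) + 1) by positivity), ← Real.sqrt_mul (by positivity),
        ← integral_const_mul]
      apply Real.sqrt_le_sqrt
      exact integral_mono_of_nonneg (.of_forall fun z => by positivity)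
        ((integrable_log_cutoff_weight.const_mul _).const_mul _) (.of_forall (hle N))
    refine squeeze_zero (fun N => Real.sqrt_nonneg _) hb ?_
    simpa using tendsto_one_div_add_atTop_nhds_zero_nat.mul_const (√(∫ z, 4 * C ^ 2 * w z))

lemma memLp_norm_pgrad_of_hasCompactSupport {χ : ℂ → ℝ} (hχ : ContDiff ℝ ∞ χ)
    (hχc : HasCompactSupport χ) : MemLp (pgrad χ) 2 :=
  (continuous_pgrad hχ).memLp_of_hasCompactSupport (hasCompactSupport_pgrad hχc)

/-- Green's formula on the sphere: there is no boundary term at infinity. -/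
lemma integral_mul_laplacian_eq {u v : ℂ → ℝ} (hu : ContDiff ℝ ∞ u) (hv : ContDiff ℝ ∞ v)
    {M : ℝ} (hM : ∀ z, |u z| ≤ M) (hgu : MemLp (pgrad u) 2) (hgv : MemLp (pgrad v) 2)
    (hΔ : Integrable (Laplacian.laplacian v)) :
    ∫ z, u z * Laplacian.laplacian v z = -∫ z, inner ℝ (pgrad u z) (pgrad v z) := by
  obtain ⟨χ, hs, hc, h0, h1, ht, hE⟩ := exists_cutoff
  have hM0 : 0 ≤ M := (abs_nonneg _).trans (hM 0)
  have hid : ∀ N, ∫ z, u z * (χ N z * Laplacian.laplacian v z) =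
      -(∫ z, χ N z * inner ℝ (pgrad u z) (pgrad v z)) -
        ∫ z, u z * inner ℝ (pgrad (χ N) z) (pgrad v z) := fun N =>
    (isWeakGradient_pgrad hu).integral_mul_laplacian hv (hs N) (hc N)
  have hi : Integrable (fun z => inner ℝ (pgrad u z) (pgrad v z)) := by
    refine Integrable.mono' (hgu.norm.integrable_mul hgv.norm)
      ((continuous_pgrad hu).inner (continuous_pgrad hv)).aestronglyMeasurable
      (.of_forall fun z => abs_real_inner_le_norm _ _)
  have hui : Integrable (fun z => M * ‖Laplacian.laplacian v z‖) := hΔ.norm.const_mul M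
  have t1 : Filter.Tendsto (fun N => ∫ z, u z * (χ N z * Laplacian.laplacian v z)) Filter.atTop
      (nhds (∫ z, u z * Laplacian.laplacian v z)) := by
    refine tendsto_integral_of_dominated_convergence _ (fun N => ?_) hui (fun N => ?_) ?_
    · exact (hu.continuous.mul ((hs N).continuous.mul (continuous_laplacian hv))).aestronglyMeasurable
    · refine .of_forall fun z => ?_
      rw [norm_mul, norm_mul, Real.norm_eq_abs, Real.norm_eq_abs, abs_of_nonneg (h0 N z)]
      calc _ ≤ M * (1 * ‖Laplacian.laplacian v z‖) := by
            have := h0 N z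
            gcongr
            exacts [hM z, h1 N z]
        _ = _ := by ring
    · refine .of_forall fun z => ?_
      have := ((ht z).mul_const (Laplacian.laplacian v z)).const_mul (u z)
      simpa using this
  have t2 : Filter.Tendsto (fun N => ∫ z, χ N z * inner ℝ (pgrad u z) (pgrad v z)) Filter.atTop
      (nhds (∫ z, inner ℝ (pgrad u z) (pgrad v z))) := by
    refine tendsto_integral_of_dominated_convergence _ (fun N => ?_) hi.norm (fun N => ?_) ?_
    · exact ((hs N).continuous.mul
        ((continuous_pgrad hu).inner (continuous_pgrad hv))).aestronglyMeasurable
    · refine .of_forall fun z => ?_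
      rw [norm_mul, Real.norm_eq_abs, abs_of_nonneg (h0 N z)]
      exact mul_le_of_le_one_left (norm_nonneg _) (h1 N z)
    · refine .of_forall fun z => ?_
      simpa using (ht z).mul_const (inner ℝ (pgrad u z) (pgrad v z))
  -- The boundary term is at most M ‖∇χ_N‖ ‖∇v‖ by Cauchy-Schwarz, so it disappears with the energy
  -- of the cutoff.
  have t3 : Filter.Tendsto (fun N => ∫ z, u z * inner ℝ (pgrad (χ N) z) (pgrad v z)) Filter.atTop
      (nhds 0) := by
    have hb : ∀ N, |∫ z, u z * inner ℝ (pgrad (χ N) z) (pgrad v z)| ≤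
        √(∫ z, ‖pgrad (χ N) z‖ ^ 2) * √(∫ z, (M * ‖pgrad v z‖) ^ 2) := by
      intro N
      refine abs_integral_le_sqrt_mul_sqrt
        (memLp_norm_pgrad_of_hasCompactSupport (hs N) (hc N)).norm (hgv.norm.const_mul M) fun z => ?_
      rw [abs_mul, abs_of_nonneg (norm_nonneg _), abs_of_nonneg (a := M * _) (by positivity)]
      calc _ ≤ M * (‖pgrad (χ N) z‖ * ‖pgrad v z‖) := by
            gcongr
            exacts [hM z, abs_real_inner_le_norm _ _]
        _ = _ := by ring
    refine squeeze_zero_norm hb ?_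
    simpa using hE.mul_const _
  have t4 := (t2.neg.sub t3)
  rw [sub_zero] at t4
  refine tendsto_nhds_unique t1 (t4.congr fun N => (hid N).symm)

/-! ### The energy inequality for solutions of the Poisson equation. -/

/-- Caccioppoli-type estimate and duality for a smooth function `H` and a cutoff `χ`. -/
lemma cutoff_energy_estimate {φ : ℂ → ℝ} {G : ℂ → ℂ} (hG : IsWeakGradient φ G) (hG2 : MemLp G 2)
    {M M' : ℝ} (hM : ∀ z, |φ z| ≤ M) {H χ : ℂ → ℝ} (hH : ContDiff ℝ ∞ H) (hM' : ∀ z, |H z| ≤ M')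
    (hχ : ContDiff ℝ ∞ χ) (hχc : HasCompactSupport χ) (hχ1 : ∀ z, |χ z| ≤ 1)
    {c : ℝ} (hc : c = √(∫ z, ‖pgrad χ z‖ ^ 2)) {J : ℝ}
    (hJ : J = -∫ z, (χ z ^ 2 * H z) * Laplacian.laplacian H z) :
    0 ≤ (M' * c) ^ 2 + J ∧ |∫ z, (χ z ^ 2 * φ z) * Laplacian.laplacian H z| ≤
      (M' * c + √((M' * c) ^ 2 + J)) * (√(∫ z, ‖G z‖ ^ 2) + 2 * M * c) := by
  have hM0 : 0 ≤ M := (abs_nonneg _).trans (hM 0)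
  have hM0' : 0 ≤ M' := (abs_nonneg _).trans (hM' 0)
  have hc0 : 0 ≤ c := hc ▸ Real.sqrt_nonneg _
  have hη : ContDiff ℝ ∞ (fun z => χ z ^ 2) := hχ.pow 2
  have hηc : HasCompactSupport (fun z => χ z ^ 2) := by
    simp only [pow_two]
    exact hχc.mul_left
  have hgη : ∀ z, pgrad (fun z => χ z ^ 2) z = (2 * χ z) • pgrad χ z := by
    intro z
    have hd := (hχ.differentiable (by simp)) z
    simp only [pow_two]
    rw [pgrad_mul hd hd, ← add_smul]; congr 1; ring
  have cH := continuous_pgrad hH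
  have mX : MemLp (fun z => χ z * ‖pgrad H z‖) 2 :=
    (hχ.continuous.mul cH.norm).memLp_of_hasCompactSupport hχc.mul_right
  have mχ := (memLp_norm_pgrad_of_hasCompactSupport hχ hχc).norm
  set X := √(∫ z, (χ z * ‖pgrad H z‖) ^ 2) with hX
  have hX0 : 0 ≤ X := Real.sqrt_nonneg _
  have hX2 : X ^ 2 = ∫ z, (χ z * ‖pgrad H z‖) ^ 2 :=
    Real.sq_sqrt (integral_nonneg fun z => by positivity)
  -- With the cutoff squared, ∇(χ²) = 2χ ∇χ leaves one factor χ to pair with ∇H, so the cross term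
  -- is controlled by the weighted norm `X` itself.
  have cross : ∀ {f : ℂ → ℝ} {B : ℝ}, (∀ z, |f z| ≤ B) →
      |∫ z, f z * inner ℝ (pgrad (fun z => χ z ^ 2) z) (pgrad H z)| ≤ 2 * B * c * X := by
    intro f B hB
    have hB0 : 0 ≤ B := (abs_nonneg _).trans (hB 0)
    have := abs_integral_le_sqrt_mul_sqrt (m := volume)
      (k := fun z => f z * inner ℝ (pgrad (fun z => χ z ^ 2) z) (pgrad H z))
      (mχ.const_mul (2 * B)) mX fun z => ?_
    · simp only [mul_pow (2 * B)] at this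
      rw [integral_const_mul, Real.sqrt_mul (by positivity), Real.sqrt_sq (by positivity)] at this
      rw [hc]; exact this
    · simp only [hgη, inner_smul_left, abs_mul, conj_trivial, abs_norm, abs_two]
      rw [abs_of_nonneg hB0]
      calc _ ≤ B * (2 * |χ z| * (‖pgrad χ z‖ * ‖pgrad H z‖)) := by
            gcongr
            exacts [hB z, abs_real_inner_le_norm _ _]
        _ = _ := by ring
  have e1 := (isWeakGradient_pgrad hH).integral_mul_laplacian hH hη hηc
  have e2 := hG.integral_mul_laplacian hH hη hηc
  have f1 : ∫ z, H z * (χ z ^ 2 * Laplacian.laplacian H z) = -J := by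
    rw [hJ, neg_neg]; congr 1; ext z; ring
  have f2 : ∫ z, φ z * (χ z ^ 2 * Laplacian.laplacian H z) =
      ∫ z, (χ z ^ 2 * φ z) * Laplacian.laplacian H z := by
    congr 1; ext z; ring
  have f3 : ∫ z, χ z ^ 2 * inner ℝ (pgrad H z) (pgrad H z) = X ^ 2 := by
    rw [hX2]; congr 1; ext z; rw [real_inner_self_eq_norm_sq]; ring
  rw [f1, f3] at e1
  rw [f2] at e2
  have b1 := abs_le.1 (cross hM')
  -- Taking H itself as the function tested gives X² ≤ J + 2M'cX; completing the square bounds X.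
  have hq : (X - M' * c) ^ 2 ≤ (M' * c) ^ 2 + J := by nlinarith [b1.1, b1.2]
  refine ⟨(sq_nonneg _).trans hq, ?_⟩
  have hXle : X ≤ M' * c + √((M' * c) ^ 2 + J) := by
    have := Real.abs_le_sqrt hq
    linarith [le_abs_self (X - M' * c)]
  have b2 : |∫ z, χ z ^ 2 * inner ℝ (G z) (pgrad H z)| ≤ X * √(∫ z, ‖G z‖ ^ 2) := by
    refine abs_integral_le_sqrt_mul_sqrt mX hG2.norm fun z => ?_
    simp only [abs_mul, abs_norm, abs_pow]
    calc _ ≤ |χ z| ^ 2 * (‖G z‖ * ‖pgrad H z‖) := by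
          gcongr
          exact abs_real_inner_le_norm _ _
      _ = |χ z| * (|χ z| * ‖pgrad H z‖ * ‖G z‖) := by ring
      _ ≤ 1 * (|χ z| * ‖pgrad H z‖ * ‖G z‖) := by
          gcongr
          exact hχ1 z
      _ = _ := one_mul _
  have b3 := cross hM
  rw [e2]
  calc _ ≤ |∫ z, χ z ^ 2 * inner ℝ (G z) (pgrad H z)| +
        |∫ z, φ z * inner ℝ (pgrad (fun z => χ z ^ 2) z) (pgrad H z)| := by
        rw [← abs_neg (∫ z, χ z ^ 2 * inner ℝ (G z) (pgrad H z))]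
        exact abs_sub _ _
    _ ≤ X * (√(∫ z, ‖G z‖ ^ 2) + 2 * M * c) := by linarith
    _ ≤ _ := by gcongr

/-- Mollification of `h` by the normalised bump function `ρ`. -/
def moll (ρ : ContDiffBump (0 : ℂ)) (h : ℂ → ℝ) : ℂ → ℝ :=
  convolution h (ρ.normed volume) (ContinuousLinearMap.lsmul ℝ ℝ) volume

lemma contDiff_moll (ρ : ContDiffBump (0 : ℂ)) {h : ℂ → ℝ} (hh : Continuous h) :
    ContDiff ℝ ∞ (moll ρ h) :=
  ρ.hasCompactSupport_normed.contDiff_convolution_right _ hh.locallyIntegrable ρ.contDiff_normed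

lemma convolution_normed_eq (ρ : ContDiffBump (0 : ℂ)) (h : ℂ → ℝ) :
    convolution (ρ.normed volume) h (ContinuousLinearMap.lsmul ℝ ℝ) volume = moll ρ h := by
  ext z
  rw [moll, convolution_lsmul_swap, convolution_lsmul]
  simp [mul_comm]

lemma abs_moll_sub_le (ρ : ContDiffBump (0 : ℂ)) {h : ℂ → ℝ} (hh : Continuous h) {ε : ℝ}
    (hε : ∀ x y, dist x y < ρ.rOut → |h x - h y| ≤ ε) (z : ℂ) : |moll ρ h z - h z| ≤ ε := by
  rw [← convolution_normed_eq, ← Real.dist_eq]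
  exact ρ.dist_normed_convolution_le hh.aestronglyMeasurable fun x hx => hε x z hx

lemma fderiv_convolution_apply {h r : ℂ → ℝ} (hh : Continuous h) (hr : ContDiff ℝ ∞ r)
    (hrc : HasCompactSupport r) (z v : ℂ) :
    fderiv ℝ (convolution h r (ContinuousLinearMap.lsmul ℝ ℝ) volume) z v =
      convolution h (fun y => fderiv ℝ r y v) (ContinuousLinearMap.lsmul ℝ ℝ) volume z := by
  rw [(hrc.hasFDerivAt_convolution_right (ContinuousLinearMap.lsmul ℝ ℝ) hh.locallyIntegrable
    (hr.of_le (by simp)) z).fderiv]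
  exact convolution_precompR_apply _ hh.locallyIntegrable (hrc.fderiv (𝕜 := ℝ))
    (hr.continuous_fderiv (by simp)) z v

lemma fderiv_comp_sub_left_apply {r : ℂ → ℝ} (hr : ContDiff ℝ ∞ r) (z t v : ℂ) :
    fderiv ℝ (fun t => r (z - t)) t v = -fderiv ℝ r (z - t) v := by
  have h1 : HasFDerivAt (fun t : ℂ => z - t) (-ContinuousLinearMap.id ℝ ℂ) t :=
    (hasFDerivAt_id t).const_sub z
  have h2 := ((hr.differentiable (by simp)) (z - t)).hasFDerivAt.comp t h1
  have h3 : fderiv ℝ (fun t => r (z - t)) t = _ := h2.fderiv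
  rw [h3]; simp

/-- The Laplacian falls on t ↦ ρ(z - t), which is an admissible test function for the distributional
equation of h; the two signs from z - t cancel. -/
lemma laplacian_moll (ρ : ContDiffBump (0 : ℂ)) {h : ℂ → ℝ} (hh : Continuous h) (z : ℂ) :
    Laplacian.laplacian (moll ρ h) z =
      ∫ t, h t * Laplacian.laplacian (fun t => ρ.normed volume (z - t)) t := by
  set r := ρ.normed volume with hr0
  have hr : ContDiff ℝ ∞ r := ρ.contDiff_normed
  have hrc : HasCompactSupport r := ρ.hasCompactSupport_normed
  have two : ∀ v, fderiv ℝ (fun w => fderiv ℝ (moll ρ h) w v) z v =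
      ∫ t, h t * fderiv ℝ (fun y => fderiv ℝ r y v) (z - t) v := by
    intro v
    have e1 : (fun w => fderiv ℝ (moll ρ h) w v) =
        convolution h (fun y => fderiv ℝ r y v) (ContinuousLinearMap.lsmul ℝ ℝ) volume :=
      funext fun w => fderiv_convolution_apply hh hr hrc w v
    rw [e1, fderiv_convolution_apply hh (contDiff_fderiv_apply hr v) (hrc.fderiv_apply (𝕜 := ℝ) v),
      convolution_lsmul]
    simp
  have hsub : ContDiff ℝ ∞ (fun t => r (z - t)) := hr.comp (contDiff_const.sub contDiff_id)
  have two' : ∀ t v, fderiv ℝ (fun w => fderiv ℝ (fun t => r (z - t)) w v) t v =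
      fderiv ℝ (fun y => fderiv ℝ r y v) (z - t) v := by
    intro t v
    have e1 : (fun w => fderiv ℝ (fun t => r (z - t)) w v) = fun w => -(fderiv ℝ r (z - w) v) :=
      funext fun w => fderiv_comp_sub_left_apply hr z w v
    rw [e1, fderiv_fun_neg, neg_apply, fderiv_comp_sub_left_apply (contDiff_fderiv_apply hr v), neg_neg]
  have hi : ∀ v, Integrable (fun t => h t * fderiv ℝ (fun y => fderiv ℝ r y v) (z - t) v) := by
    intro v
    refine Continuous.integrable_of_hasCompactSupport (hh.mul ?_) (HasCompactSupport.mul_left ?_)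
    · exact (contDiff_fderiv_apply (contDiff_fderiv_apply hr v) v).continuous.comp (by fun_prop)
    · exact ((hrc.fderiv_apply (𝕜 := ℝ) v).fderiv_apply (𝕜 := ℝ) v).comp_homeomorph
        (Homeomorph.subLeft z)
  rw [laplacian_eq (contDiff_moll ρ hh), two, two, ← integral_add (hi _) (hi _)]
  congr 1; ext t
  rw [laplacian_eq hsub, two', two']; ring

/-- Fubini together with the evenness of the bump: mollifying the measure is the same as mollifying
the function integrated against it. -/
lemma integral_mul_integral_normed (ρ : ContDiffBump (0 : ℂ)) (m : Measure ℂ) [IsFiniteMeasure m]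
    {F : ℂ → ℝ} (hF : Continuous F) (hFc : HasCompactSupport F) :
    Integrable (fun z => F z * ∫ t, ρ.normed volume (z - t) ∂m) ∧
    ∫ z, F z * ∫ t, ρ.normed volume (z - t) ∂m = ∫ t, moll ρ F t ∂m := by
  set r := ρ.normed volume with hr0
  have hr : Continuous r := ρ.continuous_normed
  obtain ⟨C, hC⟩ := (ρ.hasCompactSupport_normed (μ := volume)).exists_bound_of_continuous hr
  have hi : Integrable (fun p : ℂ × ℂ => F p.1 * r (p.1 - p.2)) (volume.prod m) := by
    have h1 : Integrable (fun p : ℂ × ℂ => F p.1 * C) (volume.prod m) :=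
      (hF.integrable_of_hasCompactSupport hFc).mul_prod (integrable_const C)
    refine Integrable.mono' h1.norm (by fun_prop) (.of_forall fun p => ?_)
    rw [norm_mul, norm_mul]
    have := (hC (p.1 - p.2)).trans (le_abs_self C)
    gcongr
    exact this
  have hi' := hi.integral_prod_left
  simp only [integral_const_mul] at hi'
  refine ⟨hi', ?_⟩
  simp only [← integral_const_mul]
  rw [integral_integral_swap hi]
  congr 1; ext t
  rw [← convolution_normed_eq, convolution_lsmul_swap]
  congr 1; ext z
  rw [hr0, ← ρ.normed_neg, neg_sub, smul_eq_mul, mul_comm]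

lemma continuous_moll (ρ : ContDiffBump (0 : ℂ)) {h : ℂ → ℝ} (hh : Continuous h) :
    Continuous (moll ρ h) := (contDiff_moll ρ hh).continuous

lemma abs_integral_moll_sub_le (ρ : ContDiffBump (0 : ℂ)) (m : Measure ℂ) [IsFiniteMeasure m]
    {F : ℂ → ℝ} (hF : Continuous F) (hFc : HasCompactSupport F) {ε : ℝ}
    (hε : ∀ x y, dist x y < ρ.rOut → |F x - F y| ≤ ε) :
    |∫ t, moll ρ F t ∂m - ∫ t, F t ∂m| ≤ ε * m.real Set.univ := by
  have hb := abs_moll_sub_le ρ hF hε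
  have iF : Integrable F m := hF.integrable_of_hasCompactSupport hFc
  have iD : Integrable (fun t => moll ρ F t - F t) m := by
    refine Integrable.mono' (integrable_const ε)
      ((continuous_moll ρ hF).sub hF).aestronglyMeasurable (.of_forall hb)
  have iM : Integrable (moll ρ F) m := by
    refine (iD.add iF).congr (.of_forall fun t => ?_)
    simp
  rw [← integral_sub iM iF]
  exact norm_integral_le_of_norm_le_const (μ := m) (f := fun t => moll ρ F t - F t) (.of_forall hb)

/-- `h` solves `Δ h = 2π (μ - ν)` in the sense of distributions on the plane. -/
def IsPoissonSolution (h : ℂ → ℝ) (μ ν : Measure ℂ) : Prop :=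
  ∀ ψ : ℂ → ℝ, ContDiff ℝ ∞ ψ → HasCompactSupport ψ →
    ∫ z, h z * Laplacian.laplacian ψ z = 2 * Real.pi * (∫ z, ψ z ∂μ - ∫ z, ψ z ∂ν)

/-- The Laplacian of the mollified h is 2π times the mollification of μ - ν. Transferring that
mollification to F costs at most the oscillation ε per unit of mass. -/
lemma abs_integral_mul_laplacian_moll_sub_le {h : ℂ → ℝ} {μ ν : Measure ℂ} [IsFiniteMeasure μ]
    [IsFiniteMeasure ν] (hp : IsPoissonSolution h μ ν) (hh : Continuous h)
    (ρ : ContDiffBump (0 : ℂ)) {F : ℂ → ℝ} (hF : Continuous F) (hFc : HasCompactSupport F) {ε : ℝ}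
    (hε : ∀ x y, dist x y < ρ.rOut → |F x - F y| ≤ ε) :
    |(∫ z, F z * Laplacian.laplacian (moll ρ h) z) -
        2 * Real.pi * (∫ z, F z ∂μ - ∫ z, F z ∂ν)| ≤
      2 * Real.pi * (ε * (μ.real Set.univ + ν.real Set.univ)) := by
  have hl : ∀ z, Laplacian.laplacian (moll ρ h) z = 2 * Real.pi *
      (∫ t, ρ.normed volume (z - t) ∂μ - ∫ t, ρ.normed volume (z - t) ∂ν) := by
    intro z
    rw [laplacian_moll ρ hh]
    refine hp _ (ρ.contDiff_normed.comp (contDiff_const.sub contDiff_id)) ?_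
    exact ρ.hasCompactSupport_normed.comp_homeomorph (Homeomorph.subLeft z)
  obtain ⟨i1, e1⟩ := integral_mul_integral_normed ρ μ hF hFc
  obtain ⟨i2, e2⟩ := integral_mul_integral_normed ρ ν hF hFc
  have e : ∫ z, F z * Laplacian.laplacian (moll ρ h) z =
      2 * Real.pi * (∫ t, moll ρ F t ∂μ - ∫ t, moll ρ F t ∂ν) := by
    rw [← e1, ← e2, ← integral_sub i1 i2, ← integral_const_mul]
    congr 1; ext z; rw [hl]; ring
  have b1 := abs_le.1 (abs_integral_moll_sub_le ρ μ hF hFc hε)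
  have b2 := abs_le.1 (abs_integral_moll_sub_le ρ ν hF hFc hε)
  rw [e, ← mul_sub, abs_mul, abs_of_pos Real.two_pi_pos]
  refine mul_le_mul_of_nonneg_left (abs_le.2 ⟨?_, ?_⟩) Real.two_pi_pos.le <;> linarith

lemma exists_bump_of_uniformContinuous {ι : Type*} [Finite ι] (f : ι → ℂ → ℝ)
    (hf : ∀ i, UniformContinuous (f i)) {ε : ℝ} (hε : 0 < ε) :
    ∃ ρ : ContDiffBump (0 : ℂ), ∀ i x y, dist x y < ρ.rOut → |f i x - f i y| ≤ ε := by
  have : ∀ i, ∃ δ > 0, ∀ x y, dist x y < δ → |f i x - f i y| ≤ ε := by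
    intro i
    obtain ⟨δ, hδ, h⟩ := Metric.uniformContinuous_iff.1 (hf i) ε hε
    exact ⟨δ, hδ, fun x y hxy => (h hxy).le⟩
  choose δ hδ h using this
  cases nonempty_fintype ι
  obtain ⟨d, hd, hd'⟩ : ∃ d > 0, ∀ i, d ≤ δ i := by
    rcases isEmpty_or_nonempty ι with he | hne
    · exact ⟨1, one_pos, fun i => (he.false i).elim⟩
    · obtain ⟨i0, hi0⟩ := Finite.exists_min δ
      exact ⟨δ i0, hδ i0, hi0⟩
  exact ⟨⟨d / 2, d, by positivity, by linarith⟩, fun i x y hxy => h i x y (hxy.trans_le (hd' i))⟩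

/-- The estimate for smooth H is applied to mollifications of h with radii tending to 0. Only
uniform convergence of the mollifications is used, since their Laplacians converge merely as
measures. -/
lemma cutoff_energy_estimate_of_isPoissonSolution {h φ : ℂ → ℝ} {G : ℂ → ℂ} {μ ν : Measure ℂ}
    [IsFiniteMeasure μ] [IsFiniteMeasure ν] (hp : IsPoissonSolution h μ ν)
    (hh : UniformContinuous h) (hφ : Continuous φ) (hG : IsWeakGradient φ G) (hG2 : MemLp G 2)
    {M M' : ℝ} (hM : ∀ z, |φ z| ≤ M) (hM' : ∀ z, |h z| ≤ M') {χ : ℂ → ℝ}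
    (hχ : ContDiff ℝ ∞ χ) (hχc : HasCompactSupport χ) (hχ1 : ∀ z, |χ z| ≤ 1)
    {c : ℝ} (hc : c = √(∫ z, ‖pgrad χ z‖ ^ 2)) {J : ℝ}
    (hJ : J = 2 * Real.pi * (∫ z, χ z ^ 2 * h z ∂ν - ∫ z, χ z ^ 2 * h z ∂μ)) :
    0 ≤ (M' * c) ^ 2 + J ∧
      |2 * Real.pi * (∫ z, χ z ^ 2 * φ z ∂μ - ∫ z, χ z ^ 2 * φ z ∂ν)| ≤
      (M' * c + √((M' * c) ^ 2 + J)) * (√(∫ z, ‖G z‖ ^ 2) + 2 * M * c) := by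
  have hc2 : ∀ {f : ℂ → ℝ}, HasCompactSupport (fun z => χ z ^ 2 * f z) := by
    intro f
    simp only [pow_two, mul_assoc]
    exact hχc.mul_right
  have cφ : Continuous (fun z => χ z ^ 2 * φ z) := (hχ.continuous.pow 2).mul hφ
  have ch : Continuous (fun z => χ z ^ 2 * h z) := (hχ.continuous.pow 2).mul hh.continuous
  have uφ : UniformContinuous (fun z => χ z ^ 2 * φ z) :=
    hc2.uniformContinuous_of_continuous cφ
  have uh : UniformContinuous (fun z => χ z ^ 2 * h z) :=
    hc2.uniformContinuous_of_continuous ch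
  set B := 2 * Real.pi * (∫ z, χ z ^ 2 * φ z ∂μ - ∫ z, χ z ^ 2 * φ z ∂ν) with hB
  set m := μ.real Set.univ + ν.real Set.univ with hm
  have hex : ∀ k : ℕ, ∃ ρ : ContDiffBump (0 : ℂ),
      ∀ i x y, dist x y < ρ.rOut →
        |(![h, fun z => χ z ^ 2 * φ z, fun z => χ z ^ 2 * h z] : Fin 3 → ℂ → ℝ) i x -
        (![h, fun z => χ z ^ 2 * φ z, fun z => χ z ^ 2 * h z] : Fin 3 → ℂ → ℝ) i y| ≤
          1 / ((k : ℝ) + 1) := by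
    intro k
    refine exists_bump_of_uniformContinuous _ (fun i => ?_) (by positivity)
    fin_cases i
    exacts [hh, uφ, uh]
  choose ρ hρ using hex
  set H : ℕ → ℂ → ℝ := fun k => moll (ρ k) h with hH
  have hHc : ∀ k, ContDiff ℝ ∞ (H k) := fun k => contDiff_moll _ hh.continuous
  have hHb : ∀ k z, |H k z - h z| ≤ 1 / ((k : ℝ) + 1) := fun k z =>
    abs_moll_sub_le _ hh.continuous (fun x y hxy => hρ k 0 x y hxy) z
  set Jk : ℕ → ℝ := fun k => -∫ z, (χ z ^ 2 * H k z) * Laplacian.laplacian (H k) z with hJk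
  set Bk : ℕ → ℝ := fun k => ∫ z, (χ z ^ 2 * φ z) * Laplacian.laplacian (H k) z with hBk
  have hzero : Filter.Tendsto (fun k : ℕ => 1 / ((k : ℝ) + 1)) Filter.atTop (nhds 0) :=
    tendsto_one_div_add_atTop_nhds_zero_nat
  have tB : Filter.Tendsto Bk Filter.atTop (nhds B) := by
    rw [tendsto_iff_dist_tendsto_zero]
    refine squeeze_zero (fun _ => dist_nonneg) (fun k => ?_)
      (g := fun k : ℕ => 2 * Real.pi * (1 / ((k : ℝ) + 1) * m)) ?_
    · exact abs_integral_mul_laplacian_moll_sub_le hp hh.continuous (ρ k) cφ hc2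
        (fun x y hxy => hρ k 1 x y hxy)
    · simpa using (hzero.mul_const m).const_mul (2 * Real.pi)
  have tJ : Filter.Tendsto Jk Filter.atTop (nhds J) := by
    rw [tendsto_iff_dist_tendsto_zero]
    refine squeeze_zero (fun _ => dist_nonneg) (fun k => ?_)
      (g := fun k : ℕ => 2 * Real.pi * (1 / ((k : ℝ) + 1) * m) +
        2 * Real.pi * (3 * (1 / ((k : ℝ) + 1)) * m)) ?_
    · have b1 := abs_integral_mul_laplacian_moll_sub_le hp hh.continuous (ρ k) ch hc2
        (fun x y hxy => hρ k 2 x y hxy)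
      have cD : Continuous (fun z => χ z ^ 2 * (H k z - h z)) :=
        (hχ.continuous.pow 2).mul ((hHc k).continuous.sub hh.continuous)
      have bD : ∀ z, |χ z ^ 2 * (H k z - h z)| ≤ 1 / ((k : ℝ) + 1) := by
        intro z
        rw [abs_mul, abs_pow]
        exact (mul_le_of_le_one_left (abs_nonneg _)
          (pow_le_one₀ (abs_nonneg _) (hχ1 z))).trans (hHb k z)
      -- The function χ²(H_k - h) is uniformly at most 1/(k + 1), so its oscillation is at most
      -- twice that at any scale. This handles its product with ΔH_k although ΔH_k need not be
      -- bounded in k.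
      have b2 := abs_integral_mul_laplacian_moll_sub_le hp hh.continuous (ρ k) cD hc2
        (ε := 2 * (1 / ((k : ℝ) + 1))) (fun x y _ => by
          have h1 := abs_le.1 (bD x)
          have h2 := abs_le.1 (bD y)
          rw [abs_le]; constructor <;> linarith)
      have b3 : ∀ (n : Measure ℂ) [IsFiniteMeasure n], |∫ z, χ z ^ 2 * (H k z - h z) ∂n| ≤
          1 / ((k : ℝ) + 1) * n.real Set.univ := fun n _ => by
        exact norm_integral_le_of_norm_le_const (μ := n)
          (f := fun z => χ z ^ 2 * (H k z - h z)) (.of_forall bD)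
      have b4 := abs_le.1 (b3 μ)
      have b5 := abs_le.1 (b3 ν)
      have cl := continuous_laplacian (hHc k)
      have hs : ∫ z, (χ z ^ 2 * H k z) * Laplacian.laplacian (H k) z =
          (∫ z, (χ z ^ 2 * h z) * Laplacian.laplacian (H k) z) +
          ∫ z, (χ z ^ 2 * (H k z - h z)) * Laplacian.laplacian (H k) z := by
        refine Eq.trans ?_ (integral_add ((ch.mul cl).integrable_of_hasCompactSupport hc2.mul_right)
          ((cD.mul cl).integrable_of_hasCompactSupport hc2.mul_right))
        congr 1; ext z; ring
      have b1' := abs_le.1 b1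
      have b2' := abs_le.1 b2
      have hpi := Real.two_pi_pos
      have b6 : 2 * Real.pi * (∫ z, χ z ^ 2 * (H k z - h z) ∂μ - ∫ z, χ z ^ 2 * (H k z - h z) ∂ν) ≤
          2 * Real.pi * (1 / ((k : ℝ) + 1) * m) :=
        mul_le_mul_of_nonneg_left (by rw [hm]; linarith) hpi.le
      have b7 : 2 * Real.pi * (-(1 / ((k : ℝ) + 1) * m)) ≤
          2 * Real.pi * (∫ z, χ z ^ 2 * (H k z - h z) ∂μ - ∫ z, χ z ^ 2 * (H k z - h z) ∂ν) :=
        mul_le_mul_of_nonneg_left (by rw [hm]; linarith) hpi.le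
      rw [Real.dist_eq]
      simp only [hJk, hJ, hs]
      rw [abs_le]
      simp only [hH] at *
      constructor <;> linarith
    · have := ((hzero.mul_const m).const_mul (2 * Real.pi)).add
        (((hzero.const_mul 3).mul_const m).const_mul (2 * Real.pi))
      simpa using this
  have est : ∀ k : ℕ, 0 ≤ ((M' + 1 / ((k : ℝ) + 1)) * c) ^ 2 + Jk k ∧ |Bk k| ≤
      ((M' + 1 / ((k : ℝ) + 1)) * c + √(((M' + 1 / ((k : ℝ) + 1)) * c) ^ 2 + Jk k)) *
        (√(∫ z, ‖G z‖ ^ 2) + 2 * M * c) := by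
    intro k
    refine cutoff_energy_estimate hG hG2 hM (hHc k) (fun z => ?_) hχ hχc hχ1 hc rfl
    have h1 := abs_le.1 (hHb k z)
    have h2 := abs_le.1 (hM' z)
    rw [abs_le]; constructor <;> linarith
  have tM : Filter.Tendsto (fun k : ℕ => (M' + 1 / ((k : ℝ) + 1)) * c) Filter.atTop
      (nhds (M' * c)) := by
    simpa using (hzero.const_add M').mul_const c
  have tS := (tM.pow 2).add tJ
  refine ⟨ge_of_tendsto' tS fun k => (est k).1, ?_⟩
  exact le_of_tendsto_of_tendsto' tB.abs
    ((tM.add (Real.continuous_sqrt.continuousAt.tendsto.comp tS)).mul_const _) fun k => (est k).2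

/-- The energy of `μ - ν` is nonnegative, and controls the integral of a function in `W^{1,2}`. -/
theorem energy_estimate {h φ : ℂ → ℝ} {G : ℂ → ℂ} {μ ν : Measure ℂ}
    [IsFiniteMeasure μ] [IsFiniteMeasure ν] (hp : IsPoissonSolution h μ ν)
    (hh : UniformContinuous h) (hφ : Continuous φ) (hG : IsWeakGradient φ G) (hG2 : MemLp G 2)
    {M M' : ℝ} (hM : ∀ z, |φ z| ≤ M) (hM' : ∀ z, |h z| ≤ M') {E : ℝ}
    (hE : E = ∫ z, h z ∂ν - ∫ z, h z ∂μ) :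
    0 ≤ E ∧ |∫ z, φ z ∂μ - ∫ z, φ z ∂ν| ≤ √E * √((2 * Real.pi)⁻¹ * ∫ z, ‖G z‖ ^ 2) := by
  obtain ⟨χ, hs, hc, h0, h1, ht, hc0⟩ := exists_cutoff
  have lim : ∀ (m : Measure ℂ) [IsFiniteMeasure m] {f : ℂ → ℝ} {K : ℝ}, Continuous f →
      (∀ z, |f z| ≤ K) → Filter.Tendsto (fun N => ∫ z, χ N z ^ 2 * f z ∂m) Filter.atTop
        (nhds (∫ z, f z ∂m)) := by
    intro m _ f K hf hK
    refine tendsto_integral_of_dominated_convergence (fun _ => K) (fun N => ?_)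
      (integrable_const K) (fun N => .of_forall fun z => ?_) (.of_forall fun z => ?_)
    · exact (((hs N).continuous.pow 2).mul hf).aestronglyMeasurable
    · rw [norm_mul, Real.norm_eq_abs, Real.norm_eq_abs, abs_of_nonneg (by positivity)]
      exact (mul_le_of_le_one_left (abs_nonneg _) (pow_le_one₀ (h0 N z) (h1 N z))).trans (hK z)
    · simpa using ((ht z).pow 2).mul_const (f z)
  have est := fun N => cutoff_energy_estimate_of_isPoissonSolution hp hh hφ hG hG2 hM hM' (hs N)
    (hc N) (fun z => by rw [abs_of_nonneg (h0 N z)]; exact h1 N z) rfl rfl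
  have tJ := ((lim ν hh.continuous hM').sub (lim μ hh.continuous hM')).const_mul (2 * Real.pi)
  have tB := ((lim μ hφ hM).sub (lim ν hφ hM)).const_mul (2 * Real.pi)
  have tM := hc0.const_mul M'
  have tS := (tM.pow 2).add tJ
  -- The cutoff terms M'c and 2Mc tend to 0, leaving 0 ≤ 2πE and the duality bound with √(2πE); the
  -- remaining lines only redistribute the factors √(2π).
  have r1 := ge_of_tendsto' tS fun N => (est N).1
  have r2 := le_of_tendsto_of_tendsto' tB.abs
    ((tM.add (Real.continuous_sqrt.continuousAt.tendsto.comp tS)).mul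
      ((hc0.const_mul (2 * M)).const_add (√(∫ z, ‖G z‖ ^ 2)))) fun N => (est N).2
  rw [← hE] at r1 r2
  have hpi := Real.two_pi_pos
  have hE0 : 0 ≤ E := by
    have : 0 ≤ 2 * Real.pi * E := by simpa using r1
    exact nonneg_of_mul_nonneg_right this hpi
  refine ⟨hE0, ?_⟩
  rw [abs_mul, abs_of_pos hpi] at r2
  simp only [mul_zero, zero_add, add_zero, ne_eq, OfNat.ofNat_ne_zero, not_false_eq_true,
    zero_pow] at r2
  rw [Real.sqrt_mul hpi.le] at r2
  rw [Real.sqrt_mul (by positivity), Real.sqrt_inv]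
  have hsq : 0 < √(2 * Real.pi) := Real.sqrt_pos.2 hpi
  have e : 2 * Real.pi = √(2 * Real.pi) * √(2 * Real.pi) := (Real.mul_self_sqrt hpi.le).symm
  have r3 : √(2 * Real.pi) * (√(2 * Real.pi) * |∫ z, φ z ∂μ - ∫ z, φ z ∂ν|) ≤
      √(2 * Real.pi) * (√E * √(∫ z, ‖G z‖ ^ 2)) := by
    rw [← mul_assoc, ← e]; linarith
  have r4 := le_of_mul_le_mul_left r3 hsq
  calc _ ≤ (√E * √(∫ z, ‖G z‖ ^ 2)) / √(2 * Real.pi) := by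
        rw [le_div_iff₀ hsq]; linarith
    _ = _ := by field_simp

/-! ### Differential calculus of the squared chordal distance. -/

lemma hasDerivAt_mk_re (q t : ℝ) : HasDerivAt (fun t : ℝ => (⟨t, q⟩ : ℂ)) 1 t := by
  have : (fun t : ℝ => (⟨t, q⟩ : ℂ)) = fun t : ℝ => (t : ℂ) + q * Complex.I := by
    ext t; apply Complex.ext <;> simp
  rw [this]
  exact (Complex.ofRealCLM.hasDerivAt).add_const _

lemma hasDerivAt_mk_im (p t : ℝ) : HasDerivAt (fun t : ℝ => (⟨p, t⟩ : ℂ)) Complex.I t := by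
  have : (fun t : ℝ => (⟨p, t⟩ : ℂ)) = fun t : ℝ => p + (t : ℂ) * Complex.I := by
    ext t; apply Complex.ext <;> simp
  rw [this]
  simpa using ((Complex.ofRealCLM.hasDerivAt (x := t)).mul_const Complex.I).const_add (p : ℂ)

lemma hasDerivAt_comp_mk_re {u : ℂ → ℝ} {z : ℂ} (hu : DifferentiableAt ℝ u z) :
    HasDerivAt (fun t : ℝ => u ⟨t, z.im⟩) (fderiv ℝ u z 1) z.re :=
  hu.hasFDerivAt.comp_hasDerivAt z.re (f := fun t : ℝ => (⟨t, z.im⟩ : ℂ)) (hasDerivAt_mk_re _ _)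

lemma hasDerivAt_comp_mk_im {u : ℂ → ℝ} {z : ℂ} (hu : DifferentiableAt ℝ u z) :
    HasDerivAt (fun t : ℝ => u ⟨z.re, t⟩) (fderiv ℝ u z Complex.I) z.im :=
  hu.hasFDerivAt.comp_hasDerivAt z.im (f := fun t : ℝ => (⟨z.re, t⟩ : ℂ)) (hasDerivAt_mk_im _ _)

lemma fderiv_apply_one_eq {u : ℂ → ℝ} {z : ℂ} {d : ℝ} (hu : DifferentiableAt ℝ u z)
    (h : HasDerivAt (fun t : ℝ => u ⟨t, z.im⟩) d z.re) : fderiv ℝ u z 1 = d :=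
  (hasDerivAt_comp_mk_re hu).unique h

lemma fderiv_apply_I_eq {u : ℂ → ℝ} {z : ℂ} {d : ℝ} (hu : DifferentiableAt ℝ u z)
    (h : HasDerivAt (fun t : ℝ => u ⟨z.re, t⟩) d z.im) : fderiv ℝ u z Complex.I = d :=
  (hasDerivAt_comp_mk_im hu).unique h

lemma fderiv_comp_apply {f : ℝ → ℝ} {s : ℂ → ℝ} (hf : Differentiable ℝ f)
    (hs : Differentiable ℝ s) (z v : ℂ) :
    fderiv ℝ (fun w => f (s w)) z v = deriv f (s z) * fderiv ℝ s z v := by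
  have : fderiv ℝ (fun w => f (s w)) z = _ := ((hf (s z)).hasDerivAt.comp_hasFDerivAt z (hs z).hasFDerivAt).fderiv
  rw [this]; simp

lemma pgrad_comp {f : ℝ → ℝ} {s : ℂ → ℝ} (hf : Differentiable ℝ f)
    (hs : Differentiable ℝ s) (z : ℂ) :
    pgrad (fun w => f (s w)) z = deriv f (s z) • pgrad s z := by
  unfold pgrad
  rw [fderiv_comp_apply hf hs, fderiv_comp_apply hf hs]
  apply Complex.ext <;> simp

lemma laplacian_comp {f : ℝ → ℝ} {s : ℂ → ℝ} (hf : ContDiff ℝ ∞ f) (hs : ContDiff ℝ ∞ s) (z : ℂ) :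
    Laplacian.laplacian (fun w => f (s w)) z =
      deriv (deriv f) (s z) * ‖pgrad s z‖ ^ 2 + deriv f (s z) * Laplacian.laplacian s z := by
  have hsd : Differentiable ℝ s := hs.differentiable (by simp)
  have hf' : ContDiff ℝ ∞ (deriv f) := (contDiff_infty_iff_deriv.1 hf).2
  have hf'd : Differentiable ℝ (deriv f) := hf'.differentiable (by simp)
  have two : ∀ v, fderiv ℝ (fun w => fderiv ℝ (fun w => f (s w)) w v) z v =
      deriv f (s z) * fderiv ℝ (fun w => fderiv ℝ s w v) z v +
        fderiv ℝ s z v * (deriv (deriv f) (s z) * fderiv ℝ s z v) := by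
    intro v
    rw [show (fun w => fderiv ℝ (fun w => f (s w)) w v) = fun w => deriv f (s w) * fderiv ℝ s w v
      from funext fun w => fderiv_comp_apply (hf.differentiable (by simp)) hsd w v]
    have hd : DifferentiableAt ℝ (fun w => deriv f (s w)) z := (hf'd.comp hsd) z
    rw [fderiv_fun_mul hd ((contDiff_fderiv_apply hs v).differentiable (by simp) z)]
    simp only [add_apply, smul_apply, smul_eq_mul]
    rw [fderiv_comp_apply hf'd hsd]
  have hfs : ContDiff ℝ ∞ (fun w => f (s w)) := hf.comp hs
  rw [laplacian_eq hfs, laplacian_eq hs, two, two, ← real_inner_self_eq_norm_sq, inner_eq_re_add_im]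
  simp only [pgrad]
  ring

/-- The squared chordal distance to `z`. -/
def chordSq (z x : P1) : ℝ := sphDist x z ^ 2

/-- The shape of the squared chordal distance in an affine chart. -/
def chordModel (A B b c : ℝ) (x : ℂ) : ℝ :=
  (A * (x.re ^ 2 + x.im ^ 2) - 2 * (b * x.re + c * x.im) + B) / (1 + (x.re ^ 2 + x.im ^ 2))

lemma contDiff_chordModel (A B b c : ℝ) : ContDiff ℝ ∞ (chordModel A B b c) := by
  have hre : ContDiff ℝ ∞ Complex.re := Complex.reCLM.contDiff
  have him : ContDiff ℝ ∞ Complex.im := Complex.imCLM.contDiff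
  unfold chordModel
  refine ContDiff.div (by fun_prop) (by fun_prop) fun x => by positivity

section Model

variable {A B b c : ℝ} (x : ℂ)

lemma chordModel_mul : chordModel A B b c x * (1 + (x.re ^ 2 + x.im ^ 2)) =
    A * (x.re ^ 2 + x.im ^ 2) - 2 * (b * x.re + c * x.im) + B := by
  unfold chordModel
  have : 1 + (x.re ^ 2 + x.im ^ 2) ≠ 0 := by positivity
  field_simp

lemma fderiv_chordModel_one : fderiv ℝ (chordModel A B b c) x 1 =
    (2 * A * x.re - 2 * b - chordModel A B b c x * (2 * x.re)) / (1 + (x.re ^ 2 + x.im ^ 2)) := by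
  refine fderiv_apply_one_eq ((contDiff_chordModel A B b c).differentiable (by simp) x) ?_
  have hD : HasDerivAt (fun t : ℝ => 1 + (t ^ 2 + x.im ^ 2)) (2 * x.re) x.re := by
    simpa using ((hasDerivAt_pow 2 x.re).add_const (x.im ^ 2)).const_add 1
  have hN : HasDerivAt (fun t : ℝ => A * (t ^ 2 + x.im ^ 2) - 2 * (b * t + c * x.im) + B)
      (2 * A * x.re - 2 * b) x.re := by
    have h1 := ((hasDerivAt_pow 2 x.re).add_const (x.im ^ 2)).const_mul A
    have h2 := (((hasDerivAt_id x.re).const_mul b).add_const (c * x.im)).const_mul 2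
    refine ((h1.sub h2).add_const B).congr_deriv ?_
    simp; ring
  have h0 : 1 + (x.re ^ 2 + x.im ^ 2) ≠ 0 := by positivity
  refine (hN.div hD h0).congr_deriv ?_
  unfold chordModel
  field_simp

lemma fderiv_chordModel_I : fderiv ℝ (chordModel A B b c) x Complex.I =
    (2 * A * x.im - 2 * c - chordModel A B b c x * (2 * x.im)) / (1 + (x.re ^ 2 + x.im ^ 2)) := by
  refine fderiv_apply_I_eq ((contDiff_chordModel A B b c).differentiable (by simp) x) ?_
  have hD : HasDerivAt (fun t : ℝ => 1 + (x.re ^ 2 + t ^ 2)) (2 * x.im) x.im := by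
    simpa using ((hasDerivAt_pow 2 x.im).const_add (x.re ^ 2)).const_add 1
  have hN : HasDerivAt (fun t : ℝ => A * (x.re ^ 2 + t ^ 2) - 2 * (b * x.re + c * t) + B)
      (2 * A * x.im - 2 * c) x.im := by
    have h1 := ((hasDerivAt_pow 2 x.im).const_add (x.re ^ 2)).const_mul A
    have h2 := (((hasDerivAt_id x.im).const_mul c).const_add (b * x.re)).const_mul 2
    refine ((h1.sub h2).add_const B).congr_deriv ?_
    simp; ring
  have h0 : 1 + (x.re ^ 2 + x.im ^ 2) ≠ 0 := by positivity
  refine (hN.div hD h0).congr_deriv ?_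
  unfold chordModel
  field_simp

/-- When A + B = 1, the function 1 - 2s is the restriction of a linear form to the unit sphere,
hence a spherical harmonic of degree one. The factor 4/(1 + |x|²)² is the conformal factor of the
round metric. -/
lemma laplacian_chordModel (hAB : A + B = 1) : Laplacian.laplacian (chordModel A B b c) x =
    4 / (1 + (x.re ^ 2 + x.im ^ 2)) ^ 2 * (1 - 2 * chordModel A B b c x) := by
  have hs := contDiff_chordModel A B b c
  have hsd := hs.differentiable (by simp)
  have h0 : 1 + (x.re ^ 2 + x.im ^ 2) ≠ 0 := by positivity
  have d1 := hasDerivAt_comp_mk_re (hsd x)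
  have d2 := hasDerivAt_comp_mk_im (hsd x)
  have e1 : fderiv ℝ (fun w => fderiv ℝ (chordModel A B b c) w 1) x 1 =
      (2 * A - 2 * chordModel A B b c x - 4 * x.re * fderiv ℝ (chordModel A B b c) x 1) /
        (1 + (x.re ^ 2 + x.im ^ 2)) := by
    refine fderiv_apply_one_eq ((contDiff_fderiv_apply hs 1).differentiable (by simp) x) ?_
    simp only [fderiv_chordModel_one]
    have hD : HasDerivAt (fun t : ℝ => 1 + (t ^ 2 + x.im ^ 2)) (2 * x.re) x.re := by
      simpa using ((hasDerivAt_pow 2 x.re).add_const (x.im ^ 2)).const_add 1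
    have h1 := (((hasDerivAt_id x.re).const_mul (2 * A)).sub_const (2 * b)).sub
      (d1.mul ((hasDerivAt_id x.re).const_mul 2))
    refine (h1.div hD h0).congr_deriv ?_
    rw [fderiv_chordModel_one]
    simp
    field_simp
    ring
  have e2 : fderiv ℝ (fun w => fderiv ℝ (chordModel A B b c) w Complex.I) x Complex.I =
      (2 * A - 2 * chordModel A B b c x - 4 * x.im * fderiv ℝ (chordModel A B b c) x Complex.I) /
        (1 + (x.re ^ 2 + x.im ^ 2)) := by
    refine fderiv_apply_I_eq ((contDiff_fderiv_apply hs _).differentiable (by simp) x) ?_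
    simp only [fderiv_chordModel_I]
    have hD : HasDerivAt (fun t : ℝ => 1 + (x.re ^ 2 + t ^ 2)) (2 * x.im) x.im := by
      simpa using ((hasDerivAt_pow 2 x.im).const_add (x.re ^ 2)).const_add 1
    have h1 := (((hasDerivAt_id x.im).const_mul (2 * A)).sub_const (2 * c)).sub
      (d2.mul ((hasDerivAt_id x.im).const_mul 2))
    refine (h1.div hD h0).congr_deriv ?_
    rw [fderiv_chordModel_I]
    simp
    field_simp
    ring
  rw [laplacian_eq hs, e1, e2, fderiv_chordModel_one, fderiv_chordModel_I]
  have hm := chordModel_mul (A := A) (B := B) (b := b) (c := c) x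
  set s := chordModel A B b c x
  field_simp
  linear_combination (4 : ℝ) * hm + 4 * hAB

/-- The condition b² + c² = AB normalises the linear form 1 - 2s to be the cosine of the angle to a
point, and |∇ cos θ|² = 1 - cos² θ becomes s(1 - s) for s. -/
lemma norm_sq_pgrad_chordModel (hAB : A + B = 1) (hbc : b ^ 2 + c ^ 2 = A * B) :
    ‖pgrad (chordModel A B b c) x‖ ^ 2 = 4 / (1 + (x.re ^ 2 + x.im ^ 2)) ^ 2 *
      (chordModel A B b c x * (1 - chordModel A B b c x)) := by
  rw [← real_inner_self_eq_norm_sq, inner_eq_re_add_im]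
  simp only [pgrad, fderiv_chordModel_one, fderiv_chordModel_I]
  have hm := chordModel_mul (A := A) (B := B) (b := b) (c := c) x
  have h0 : 1 + (x.re ^ 2 + x.im ^ 2) ≠ 0 := by positivity
  set s := chordModel A B b c x
  field_simp
  linear_combination 4 * hbc + (4 * (A - s)) * (-hm) + (4 * s) * hAB

end Model

lemma chordSq_chartZero_eq (z : P1) : ∃ A B b c : ℝ, A + B = 1 ∧ b ^ 2 + c ^ 2 = A * B ∧
    chordSq z ∘ chartZero = chordModel A B b c ∧ chordSq z ∘ chartInfty = chordModel B A b (-c) := by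
  set p := (homCoord z).1 with hp
  set q := (homCoord z).2 with hq
  have hL : 0 < ‖p‖ ^ 2 + ‖q‖ ^ 2 := by
    induction z using OnePoint.rec with
    | infty => simp [hp, hq, homCoord]
    | coe z => simp [hp, hq, homCoord]; positivity
  have hD : ∀ x y : ℂ, (√(‖x‖ ^ 2 + ‖y‖ ^ 2) * √(‖p‖ ^ 2 + ‖q‖ ^ 2)) ^ 2 =
      (‖x‖ ^ 2 + ‖y‖ ^ 2) * (‖p‖ ^ 2 + ‖q‖ ^ 2) := fun x y => by
    rw [mul_pow, Real.sq_sqrt (by positivity), Real.sq_sqrt (by positivity)]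
  have hgen : ∀ x : P1, chordSq z x = ‖(homCoord x).1 * q - (homCoord x).2 * p‖ ^ 2 /
      ((‖(homCoord x).1‖ ^ 2 + ‖(homCoord x).2‖ ^ 2) * (‖p‖ ^ 2 + ‖q‖ ^ 2)) := fun x => by
    rw [chordSq, sphDist, div_pow, hD]
  have nsq : ∀ w : ℂ, ‖w‖ ^ 2 = w.re ^ 2 + w.im ^ 2 := fun w => by
    rw [← Complex.normSq_eq_norm_sq, Complex.normSq_apply]; ring
  -- For z = [p : q] the square |xq - p|² is expanded: b + ic is p times the conjugate of q, over
  -- ‖p‖² + ‖q‖². The chart at infinity exchanges p and q, whence A ↔ B and c ↦ -c.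
  refine ⟨‖q‖ ^ 2 / (‖p‖ ^ 2 + ‖q‖ ^ 2), ‖p‖ ^ 2 / (‖p‖ ^ 2 + ‖q‖ ^ 2),
    (p.re * q.re + p.im * q.im) / (‖p‖ ^ 2 + ‖q‖ ^ 2),
    (p.im * q.re - p.re * q.im) / (‖p‖ ^ 2 + ‖q‖ ^ 2), ?_, ?_, ?_, ?_⟩
  · field_simp; ring
  · field_simp
    rw [nsq, nsq]; ring
  · ext x
    have hx : homCoord (chartZero x) = (x, 1) := rfl
    simp only [Function.comp, hgen, hx, chordModel]
    have h0 : 1 + (x.re ^ 2 + x.im ^ 2) ≠ 0 := by positivity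
    have h1 : ‖x‖ ^ 2 + ‖(1 : ℂ)‖ ^ 2 = 1 + (x.re ^ 2 + x.im ^ 2) := by rw [nsq]; simp; ring
    rw [h1]
    field_simp
    rw [nsq, nsq, nsq]
    simp
    ring
  · ext w
    have key : chordSq z (chartInfty w) = ‖q - w * p‖ ^ 2 /
        ((1 + ‖w‖ ^ 2) * (‖p‖ ^ 2 + ‖q‖ ^ 2)) := by
      rw [hgen]
      by_cases hw : w = 0
      · have : homCoord (chartInfty w) = (1, 0) := by rw [chartInfty, if_pos hw]; rfl
        rw [this]
        simp [hw]
      · have : homCoord (chartInfty w) = (w⁻¹, 1) := by rw [chartInfty, if_neg hw]; rfl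
        rw [this]
        have hw' : ‖w‖ ≠ 0 := by simpa using hw
        have e : w⁻¹ * q - 1 * p = w⁻¹ * (q - w * p) := by field_simp
        simp only [e, norm_mul, norm_inv, norm_one]
        field_simp
    simp only [Function.comp, key, chordModel]
    have h0 : 1 + (w.re ^ 2 + w.im ^ 2) ≠ 0 := by positivity
    have h1 : 1 + ‖w‖ ^ 2 = 1 + (w.re ^ 2 + w.im ^ 2) := by rw [nsq]
    rw [h1]
    field_simp
    rw [nsq, nsq, nsq]
    simp
    ring

/-! ### The regularised logarithm as a function of one real variable. -/

/-- A smooth step, equal to `0` on `(-∞, δ/4]` and to `1` on `[δ, ∞)`. -/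
def stepFun (δ t : ℝ) : ℝ := Real.smoothTransition ((4 * t / δ - 1) / 3)

/-- Twice the derivative of `regLog δ`. -/
def regLogDeriv (δ t : ℝ) : ℝ := stepFun δ t / t - (1 - stepFun δ t) / (1 - t)

/-- A smooth function on `ℝ`, equal to `t ↦ (1 / 2) log t` on `[δ, 1]`, such that
`regLog δ (d(x, z)²)` is a regularisation of `log d(x, z)`. -/
def regLog (δ s : ℝ) : ℝ := (∫ t in (1 : ℝ)..s, regLogDeriv δ t) / 2

lemma contDiff_stepFun (δ : ℝ) : ContDiff ℝ ∞ (stepFun δ) :=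
  (Real.smoothTransition.contDiff (n := ⊤)).comp
    (((contDiff_const.mul contDiff_id).div_const δ).sub contDiff_const |>.div_const 3)

lemma stepFun_nonneg (δ t : ℝ) : 0 ≤ stepFun δ t := Real.smoothTransition.nonneg _

lemma stepFun_le_one (δ t : ℝ) : stepFun δ t ≤ 1 := Real.smoothTransition.le_one _

section Profile

variable {δ : ℝ} (hδ : 0 < δ)

include hδ

lemma stepFun_of_le {t : ℝ} (ht : t ≤ δ / 4) : stepFun δ t = 0 := by
  apply Real.smoothTransition.zero_of_nonpos
  have : 4 * t / δ ≤ 1 := by rw [div_le_one hδ]; linarith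
  linarith

lemma stepFun_of_ge {t : ℝ} (ht : δ ≤ t) : stepFun δ t = 1 := by
  apply Real.smoothTransition.one_of_one_le
  have : 4 ≤ 4 * t / δ := by rw [le_div_iff₀ hδ]; linarith
  linarith

lemma deriv_stepFun_nonneg (t : ℝ) : 0 ≤ deriv (stepFun δ) t := by
  refine Monotone.deriv_nonneg fun a b hab => Real.smoothTransition.monotone ?_
  have : 4 * a / δ ≤ 4 * b / δ := by gcongr
  linarith

lemma mem_Icc_of_deriv_stepFun_ne_zero {t : ℝ} (ht : deriv (stepFun δ) t ≠ 0) :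
    δ / 4 ≤ t ∧ t ≤ δ := by
  constructor
  · by_contra! h
    apply ht
    have : stepFun δ =ᶠ[nhds t] fun _ => 0 := by
      filter_upwards [gt_mem_nhds h] with s hs using stepFun_of_le hδ (le_of_lt hs)
    rw [this.deriv_eq]; simp
  · by_contra! h
    apply ht
    have : stepFun δ =ᶠ[nhds t] fun _ => 1 := by
      filter_upwards [lt_mem_nhds h] with s hs using stepFun_of_ge hδ (le_of_lt hs)
    rw [this.deriv_eq]; simp

variable (hδ1 : δ ≤ 1 / 2)

include hδ1

/-- For (1/2) log t the right side would be 1 - t; the step replaces the constant 1. At t = 0 and t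
= 1 both sides vanish, because the step is 0 near 0 and 1 near 1, which also makes the two poles of
`regLogDeriv` removable. -/
lemma mul_regLogDeriv (t : ℝ) : t * (1 - t) * regLogDeriv δ t = stepFun δ t - t := by
  unfold regLogDeriv
  rcases eq_or_ne t 0 with rfl | h0
  · simp [stepFun_of_le hδ (show (0 : ℝ) ≤ δ / 4 by positivity)]
  rcases eq_or_ne t 1 with rfl | h1
  · simp [stepFun_of_ge hδ (show δ ≤ 1 by linarith)]
  have : 1 - t ≠ 0 := sub_ne_zero.2 h1.symm
  field_simp
  ring

lemma contDiff_regLogDeriv : ContDiff ℝ ∞ (regLogDeriv δ) := by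
  rw [contDiff_iff_contDiffAt]
  intro t
  have hs := (contDiff_stepFun δ).contDiffAt (x := t)
  have e : regLogDeriv δ = fun t => stepFun δ t / t - (1 - stepFun δ t) / (1 - t) := rfl
  rw [e]
  refine ContDiffAt.sub ?_ ?_
  · rcases eq_or_ne t 0 with rfl | h0
    · refine (contDiffAt_const (c := (0 : ℝ))).congr_of_eventuallyEq ?_
      filter_upwards [gt_mem_nhds (show (0 : ℝ) < δ / 4 by positivity)] with s hs
      rw [stepFun_of_le hδ (le_of_lt hs), zero_div]
    · exact hs.div contDiffAt_id h0
  · rcases eq_or_ne t 1 with rfl | h1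
    · refine (contDiffAt_const (c := (0 : ℝ))).congr_of_eventuallyEq ?_
      filter_upwards [lt_mem_nhds (show δ < 1 by linarith)] with s hs
      rw [stepFun_of_ge hδ (le_of_lt hs), sub_self, zero_div]
    · exact (contDiffAt_const.sub hs).div (contDiffAt_const.sub contDiffAt_id)
        (sub_ne_zero.2 h1.symm)

lemma hasDerivAt_regLog (s : ℝ) : HasDerivAt (regLog δ) (regLogDeriv δ s / 2) s := by
  have hc := (contDiff_regLogDeriv hδ hδ1).continuous
  exact (intervalIntegral.integral_hasDerivAt_right (hc.intervalIntegrable _ _)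
    (hc.stronglyMeasurableAtFilter _ _) hc.continuousAt).div_const 2

lemma deriv_regLog : deriv (regLog δ) = fun s => regLogDeriv δ s / 2 :=
  funext fun s => (hasDerivAt_regLog hδ hδ1 s).deriv

lemma contDiff_regLog : ContDiff ℝ ∞ (regLog δ) := by
  rw [contDiff_infty_iff_deriv, deriv_regLog hδ hδ1]
  exact ⟨fun s => (hasDerivAt_regLog hδ hδ1 s).differentiableAt,
    (contDiff_regLogDeriv hδ hδ1).div_const 2⟩

/-- Derivative of the first-order identity `mul_regLogDeriv`. On the sphere it says that the
regularised logarithm has dd^c equal to a smoothed point mass minus ω. -/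
lemma regLog_ode (t : ℝ) : 2 * (t * (1 - t) * deriv (deriv (regLog δ)) t +
    (1 - 2 * t) * deriv (regLog δ) t) = deriv (stepFun δ) t - 1 := by
  have hT := contDiff_regLog hδ hδ1
  have h1 : HasDerivAt (fun t => t * (1 - t) * deriv (regLog δ) t)
      ((1 * (1 - t) + t * (-1)) * deriv (regLog δ) t + t * (1 - t) * deriv (deriv (regLog δ)) t) t :=
    ((hasDerivAt_id t).mul ((hasDerivAt_id t).const_sub 1)).mul
      (((contDiff_infty_iff_deriv.1 hT).2.differentiable (by simp)) t).hasDerivAt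
  have h2 : HasDerivAt (fun t => t * (1 - t) * deriv (regLog δ) t)
      ((deriv (stepFun δ) t - 1) / 2) t := by
    have e : (fun t => t * (1 - t) * deriv (regLog δ) t) = fun t => (stepFun δ t - t) / 2 := by
      ext t
      rw [deriv_regLog hδ hδ1, ← mul_regLogDeriv hδ hδ1]
      ring
    rw [e]
    exact ((((contDiff_stepFun δ).differentiable (by simp)) t).hasDerivAt.sub
      (hasDerivAt_id t)).div_const 2
  have := h1.unique h2
  linarith

omit hδ hδ1 in
lemma regLog_one : regLog δ 1 = 0 := by simp [regLog]

lemma hasDerivAt_regLog_sub_log {s : ℝ} (h0 : 0 < s) (h1 : s < 1) :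
    HasDerivAt (fun s => regLog δ s - 1 / 2 * Real.log s) (-(1 - stepFun δ s) / (2 * s * (1 - s))) s := by
  refine ((hasDerivAt_regLog hδ hδ1 s).sub ((Real.hasDerivAt_log h0.ne').const_mul _)).congr_deriv ?_
  have : 1 - s ≠ 0 := by linarith
  unfold regLogDeriv
  field_simp
  ring

lemma continuousOn_regLog_sub_log {a : ℝ} (ha : 0 < a) :
    ContinuousOn (fun s => regLog δ s - 1 / 2 * Real.log s) (Set.Icc a 1) := by
  refine (contDiff_regLog hδ hδ1).continuous.continuousOn.sub (ContinuousOn.mul continuousOn_const ?_)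
  exact Real.continuousOn_log.mono fun x hx => (ha.trans_le hx.1).ne'

/-- The difference from (1/2) log s is nonincreasing and vanishes at s = 1. -/
lemma log_le_regLog {s : ℝ} (h0 : 0 < s) (h1 : s ≤ 1) : 1 / 2 * Real.log s ≤ regLog δ s := by
  have hanti : AntitoneOn (fun s => regLog δ s - 1 / 2 * Real.log s) (Set.Icc s 1) := by
    refine antitoneOn_of_deriv_nonpos (convex_Icc s 1) (continuousOn_regLog_sub_log hδ hδ1 h0) ?_ ?_
    · intro x hx
      rw [interior_Icc] at hx
      exact (hasDerivAt_regLog_sub_log hδ hδ1 (h0.trans hx.1) hx.2).differentiableAt.differentiableWithinAt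
    · intro x hx
      rw [interior_Icc] at hx
      rw [(hasDerivAt_regLog_sub_log hδ hδ1 (h0.trans hx.1) hx.2).deriv]
      have hx0 : 0 < x := h0.trans hx.1
      refine div_nonpos_of_nonpos_of_nonneg (by linarith [stepFun_le_one δ x]) ?_
      have : 0 < 1 - x := by linarith [hx.2]
      positivity
  have := hanti (Set.left_mem_Icc.2 h1) (Set.right_mem_Icc.2 h1) h1
  simp only [regLog_one, Real.log_one] at this
  linarith

lemma regLog_eq_log {s : ℝ} (h0 : δ ≤ s) (h1 : s ≤ 1) : regLog δ s = 1 / 2 * Real.log s := by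
  have hs0 : 0 < s := hδ.trans_le h0
  have hmono : MonotoneOn (fun s => regLog δ s - 1 / 2 * Real.log s) (Set.Icc s 1) := by
    refine monotoneOn_of_deriv_nonneg (convex_Icc s 1) (continuousOn_regLog_sub_log hδ hδ1 hs0) ?_ ?_
    · intro x hx
      rw [interior_Icc] at hx
      exact (hasDerivAt_regLog_sub_log hδ hδ1 (hs0.trans hx.1) hx.2).differentiableAt.differentiableWithinAt
    · intro x hx
      rw [interior_Icc] at hx
      rw [(hasDerivAt_regLog_sub_log hδ hδ1 (hs0.trans hx.1) hx.2).deriv,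
        stepFun_of_ge hδ (h0.trans hx.1.le)]
      simp
  have := hmono (Set.left_mem_Icc.2 h1) (Set.right_mem_Icc.2 h1) h1
  simp only [regLog_one, Real.log_one] at this
  linarith [log_le_regLog hδ hδ1 hs0 h1]

lemma neg_log_one_sub_le : -Real.log (1 - δ) ≤ 1 := by
  have h2 : Real.log 2 ≤ 1 := by linarith [Real.log_two_lt_d9]
  have : Real.log (1 / 2) ≤ Real.log (1 - δ) := Real.log_le_log (by norm_num) (by linarith)
  rw [one_div, Real.log_inv] at this
  linarith

/-- Adding -(1/2) log(1 - s) cancels the negative part of the derivative, so the sum is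
nondecreasing and is compared with its value at δ, where the regularisation is exact. -/
lemma regLog_le {s : ℝ} (h0 : 0 ≤ s) (h1 : s ≤ δ) :
    regLog δ s ≤ 1 / 2 * Real.log δ - 1 / 2 * Real.log (1 - δ) := by
  have hd : ∀ x < 1, HasDerivAt (fun s => regLog δ s - 1 / 2 * Real.log (1 - s))
      (regLogDeriv δ x / 2 - 1 / 2 * (-1 / (1 - x))) x := fun x hx =>
    (hasDerivAt_regLog hδ hδ1 x).sub
      (((((hasDerivAt_id x).const_sub 1).log (by simp; linarith)).const_mul (1 / 2)))
  have hmono : MonotoneOn (fun s => regLog δ s - 1 / 2 * Real.log (1 - s)) (Set.Icc s δ) := by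
    refine monotoneOn_of_deriv_nonneg (convex_Icc s δ)
      (fun x hx => (hd x (by linarith [hx.2])).continuousAt.continuousWithinAt) ?_ ?_
    · intro x hx
      rw [interior_Icc] at hx
      exact (hd x (by linarith [hx.2])).differentiableAt.differentiableWithinAt
    · intro x hx
      rw [interior_Icc] at hx
      rw [(hd x (by linarith [hx.2])).deriv]
      have hx1 : 0 < 1 - x := by linarith [hx.2]
      have hx0 : 0 ≤ x := h0.trans hx.1.le
      have e : regLogDeriv δ x / 2 - 1 / 2 * (-1 / (1 - x)) =
          (stepFun δ x / x + stepFun δ x / (1 - x)) / 2 := by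
        unfold regLogDeriv
        field_simp
        ring
      rw [e]
      have := stepFun_nonneg δ x
      positivity
  have h := hmono (Set.left_mem_Icc.2 h1) (Set.right_mem_Icc.2 h1) h1
  simp only at h
  rw [regLog_eq_log hδ hδ1 le_rfl (by linarith)] at h
  have : Real.log (1 - s) ≤ 0 := Real.log_nonpos (by linarith) (by linarith)
  linarith

lemma regLog_nonpos {s : ℝ} (h0 : 0 ≤ s) (h1 : s ≤ 1) : regLog δ s ≤ 0 := by
  rcases le_total s δ with h | h
  · have := regLog_le hδ hδ1 h0 h
    have h2 : Real.log δ ≤ Real.log (1 - δ) := Real.log_le_log hδ (by linarith)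
    linarith
  · rw [regLog_eq_log hδ hδ1 h h1]
    have := Real.log_nonpos h0 h1
    linarith

/-- The integral of (1/2) log t over [0, 1] is -1/2, and regularising changes the integrand only on
[0, δ]. There the terms in δ log δ cancel and the excess is (δ/2)(1 - log(1 - δ)) ≤ δ. -/
lemma integral_regLog_mem : -(1 / 2) ≤ ∫ t in (0 : ℝ)..1, regLog δ t ∧
    ∫ t in (0 : ℝ)..1, regLog δ t ≤ -(1 / 2) + δ := by
  have hc := (contDiff_regLog hδ hδ1).continuous
  have hi : ∀ a b, IntervalIntegrable (regLog δ) volume a b := fun a b => hc.intervalIntegrable a b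
  have hl : ∀ a b, IntervalIntegrable (fun t => 1 / 2 * Real.log t) volume a b := fun a b =>
    (intervalIntegral.intervalIntegrable_log').const_mul _
  constructor
  · have : ∫ t in (0 : ℝ)..1, 1 / 2 * Real.log t = -(1 / 2) := by
      rw [intervalIntegral.integral_const_mul, integral_log]; simp
    rw [← this]
    exact intervalIntegral.integral_mono_on_of_le_Ioo zero_le_one (hl _ _) (hi _ _)
      fun t ht => log_le_regLog hδ hδ1 ht.1 ht.2.le
  · rw [← intervalIntegral.integral_add_adjacent_intervals (hi 0 δ) (hi δ 1)]
    have e1 : ∫ t in δ..1, regLog δ t = ∫ t in δ..1, 1 / 2 * Real.log t := by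
      refine intervalIntegral.integral_congr fun t ht => ?_
      rw [Set.uIcc_of_le (by linarith)] at ht
      exact regLog_eq_log hδ hδ1 ht.1 ht.2
    have e2 : ∫ t in δ..1, 1 / 2 * Real.log t = 1 / 2 * (-1 - δ * Real.log δ + δ) := by
      rw [intervalIntegral.integral_const_mul, integral_log]; simp; ring
    have e3 : ∫ t in (0 : ℝ)..δ, regLog δ t ≤
        ∫ t in (0 : ℝ)..δ, (1 / 2 * Real.log δ - 1 / 2 * Real.log (1 - δ)) :=
      intervalIntegral.integral_mono_on hδ.le (hi _ _) (by simp)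
        fun t ht => regLog_le hδ hδ1 ht.1 ht.2
    rw [intervalIntegral.integral_const, smul_eq_mul, sub_zero] at e3
    rw [e1, e2]
    nlinarith [neg_log_one_sub_le hδ hδ1]

end Profile

/-! ### The chordal distance and smooth functions on the sphere. -/

lemma sphDist_nonneg (x y : P1) : 0 ≤ sphDist x y := by unfold sphDist; positivity

lemma sphDist_comm (x y : P1) : sphDist x y = sphDist y x := by
  unfold sphDist
  rw [mul_comm (√_) (√_), ← norm_neg]
  congr 2; ring

lemma chordSq_nonneg (z x : P1) : 0 ≤ chordSq z x := sq_nonneg _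

lemma sqrt_homCoord_pos (x : P1) : 0 < √(‖(homCoord x).1‖ ^ 2 + ‖(homCoord x).2‖ ^ 2) := by
  apply Real.sqrt_pos.2
  induction x using OnePoint.rec with
  | infty => simp [homCoord]
  | coe z => simp [homCoord]; positivity

lemma sphDist_le_one (x y : P1) : sphDist x y ≤ 1 := by
  unfold sphDist
  have h1 := sqrt_homCoord_pos x
  have h2 := sqrt_homCoord_pos y
  rw [div_le_one (by positivity), ← Real.sqrt_mul (by positivity)]
  apply Real.le_sqrt_of_sq_le
  have h3 := norm_sub_le ((homCoord x).1 * (homCoord y).2) ((homCoord x).2 * (homCoord y).1)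
  rw [norm_mul, norm_mul] at h3
  have h4 := pow_le_pow_left₀ (norm_nonneg _) h3 2
  nlinarith [sq_nonneg (‖(homCoord x).1‖ * ‖(homCoord y).1‖ - ‖(homCoord x).2‖ * ‖(homCoord y).2‖)]

lemma chordSq_le_one (z x : P1) : chordSq z x ≤ 1 :=
  pow_le_one₀ (sphDist_nonneg _ _) (sphDist_le_one _ _)

lemma sphDist_eq_zero_iff {x y : P1} : sphDist x y = 0 ↔ x = y := by
  constructor
  · intro h
    have h1 := sqrt_homCoord_pos x
    have h2 := sqrt_homCoord_pos y
    unfold sphDist at h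
    rw [div_eq_zero_iff, or_iff_left (by positivity), norm_eq_zero, sub_eq_zero] at h
    induction x using OnePoint.rec with
    | infty =>
      induction y using OnePoint.rec with
      | infty => rfl
      | coe w => simp [homCoord] at h
    | coe z =>
      induction y using OnePoint.rec with
      | infty => simp [homCoord] at h
      | coe w => simpa [homCoord] using h
  · rintro rfl
    simp [sphDist, mul_comm]

lemma sphDist_pos {x y : P1} (h : x ≠ y) : 0 < sphDist x y :=
  (sphDist_nonneg x y).lt_of_ne fun h0 => h (sphDist_eq_zero_iff.1 h0.symm)

lemma chordSq_pos {x y : P1} (h : x ≠ y) : 0 < chordSq x y := pow_pos (sphDist_pos h.symm) 2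

/-- It holds on the diagonal too, both logarithms of 0 being 0 by convention. -/
lemma log_sphDist (x y : P1) : Real.log (sphDist x y) = 1 / 2 * Real.log (chordSq y x) := by
  rw [chordSq, Real.log_pow]; push_cast; ring

lemma IsSmooth.continuous {ψ : P1 → ℝ} (h : IsSmooth ψ) : Continuous ψ := by
  rw [OnePoint.continuous_iff]
  refine ⟨?_, h.1.continuous⟩
  have h1 := h.2.continuous.continuousAt (x := 0)
  have e0 : (ψ ∘ chartInfty) 0 = ψ OnePoint.infty := by simp [chartInfty]
  rw [ContinuousAt, e0] at h1
  rw [Filter.coclosedCompact_eq_cocompact, ← Metric.cobounded_eq_cocompact]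
  have h2 := h1.comp (Filter.tendsto_inv₀_cobounded (α := ℂ))
  refine h2.congr' ?_
  have : ∀ᶠ x : ℂ in Bornology.cobounded ℂ, x ≠ 0 := by
    rw [Metric.cobounded_eq_cocompact]
    exact (isCompact_singleton (x := (0 : ℂ))).compl_mem_cocompact
  filter_upwards [this] with x hx
  simp [chartInfty, hx]

lemma isSmooth_comp_chordSq {f : ℝ → ℝ} (hf : ContDiff ℝ ∞ f) (z : P1) :
    IsSmooth (fun x => f (chordSq z x)) := by
  obtain ⟨A, B, b, c, -, -, h0, h1⟩ := chordSq_chartZero_eq z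
  constructor
  · change ContDiff ℝ ∞ (f ∘ (chordSq z ∘ chartZero))
    rw [h0]; exact hf.comp (contDiff_chordModel _ _ _ _)
  · change ContDiff ℝ ∞ (f ∘ (chordSq z ∘ chartInfty))
    rw [h1]; exact hf.comp (contDiff_chordModel _ _ _ _)

lemma continuous_chordSq (z : P1) : Continuous (chordSq z) :=
  (isSmooth_comp_chordSq contDiff_id z).continuous

/-! ### Integration against the Fubini-Study form. -/

/-- The density of the Fubini-Study form in the affine chart. -/
def fsDensity (z : ℂ) : ℝ := 1 / (Real.pi * (1 + ‖z‖ ^ 2) ^ 2)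

lemma fsDensity_nonneg (z : ℂ) : 0 ≤ fsDensity z := by unfold fsDensity; positivity

lemma continuous_fsDensity : Continuous fsDensity := by
  unfold fsDensity
  refine Continuous.div (by fun_prop) (by fun_prop) fun z => by positivity

lemma measurableEmbedding_chartZero : MeasurableEmbedding chartZero :=
  OnePoint.isOpenEmbedding_coe.measurableEmbedding

lemma integral_fubiniStudy (f : P1 → ℝ) :
    ∫ x, f x ∂fubiniStudy = ∫ z, fsDensity z * f (chartZero z) := by
  rw [fubiniStudy, measurableEmbedding_chartZero.integral_map,
    integral_withDensity_eq_integral_toReal_smul]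
  · congr 1; ext z
    change (ENNReal.ofReal (fsDensity z)).toReal • _ = _
    rw [ENNReal.toReal_ofReal (fsDensity_nonneg z), smul_eq_mul]
  · exact (continuous_fsDensity.measurable).ennreal_ofReal
  · simp

lemma integrable_fsDensity : Integrable fsDensity := by
  have key : IntegrableOn (fun r : ℝ => 2 * r / (1 + r ^ 2) ^ 2) (Set.Ioi 0) := by
    refine integrableOn_Ioi_deriv_of_nonneg' (g := fun r => -(1 + r ^ 2)⁻¹)
      (l := 0) (fun r _ => ?_) (fun r hr => ?_) ?_
    · have h0 : HasDerivAt (fun r : ℝ => 1 + r ^ 2) (2 * r) r := by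
        simpa using (hasDerivAt_pow 2 r).const_add 1
      exact ((h0.inv (by positivity)).neg).congr_deriv (by rw [neg_div, neg_neg])
    · have : 0 < r := hr
      positivity
    · rw [← neg_zero]
      refine Filter.Tendsto.neg (Filter.Tendsto.inv_tendsto_atTop ?_)
      exact Filter.tendsto_atTop_add_const_left _ _ (Filter.tendsto_pow_atTop (by norm_num))
  refine (integrable_fun_norm_addHaar (E := ℂ) volume
    (f := fun r : ℝ => 1 / (Real.pi * (1 + r ^ 2) ^ 2))).2 ?_
  refine (key.const_mul (1 / (2 * Real.pi))).congr (.of_forall fun r => ?_)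
  simp only [Complex.finrank_real_complex, smul_eq_mul]
  field_simp
  norm_num

lemma integral_fsDensity : ∫ z, fsDensity z = 1 := by
  have h1 := integral_fun_norm_addHaar (E := ℂ) volume
    (fun r : ℝ => 1 / (Real.pi * (1 + r ^ 2) ^ 2))
  have h2 : ∫ r in Set.Ioi (0 : ℝ), 2 * r / (1 + r ^ 2) ^ 2 = 0 - (-(1 + (0 : ℝ) ^ 2)⁻¹) := by
    refine integral_Ioi_of_hasDerivAt_of_nonneg' (g := fun r => -(1 + r ^ 2)⁻¹)
      (fun r _ => ?_) (fun r hr => ?_) ?_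
    · have h0 : HasDerivAt (fun r : ℝ => 1 + r ^ 2) (2 * r) r := by
        simpa using (hasDerivAt_pow 2 r).const_add 1
      exact ((h0.inv (by positivity)).neg).congr_deriv (by rw [neg_div, neg_neg])
    · have : 0 < r := hr
      positivity
    · rw [← neg_zero]
      refine Filter.Tendsto.neg (Filter.Tendsto.inv_tendsto_atTop ?_)
      exact Filter.tendsto_atTop_add_const_left _ _ (Filter.tendsto_pow_atTop (by norm_num))
  have h3 : ∫ y in Set.Ioi (0 : ℝ), y ^ (Module.finrank ℝ ℂ - 1) • (1 / (Real.pi * (1 + y ^ 2) ^ 2)) =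
      1 / (2 * Real.pi) * ∫ r in Set.Ioi (0 : ℝ), 2 * r / (1 + r ^ 2) ^ 2 := by
    rw [← integral_const_mul]
    congr 1; ext r
    simp only [Complex.finrank_real_complex, smul_eq_mul]
    field_simp
    norm_num
  change ∫ z : ℂ, 1 / (Real.pi * (1 + ‖z‖ ^ 2) ^ 2) = 1
  rw [h1, h3, h2]
  have hb : volume.real (Metric.ball (0 : ℂ) 1) = Real.pi := by
    simp [Measure.real, Complex.volume_ball]
  rw [hb]
  simp [Complex.finrank_real_complex]

instance isProbabilityMeasure_fubiniStudy : IsProbabilityMeasure fubiniStudy := by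
  constructor
  have h : ∫⁻ z, ENNReal.ofReal (fsDensity z) = 1 := by
    rw [← ofReal_integral_eq_lintegral_ofReal integrable_fsDensity (.of_forall fsDensity_nonneg),
      integral_fsDensity, ENNReal.ofReal_one]
  rw [fubiniStudy, measurableEmbedding_chartZero.map_apply, Set.preimage_univ,
    withDensity_apply _ MeasurableSet.univ, Measure.restrict_univ]
  exact h

lemma exists_abs_le_of_continuous {f : P1 → ℝ} (hf : Continuous f) : ∃ M, ∀ x, |f x| ≤ M := by
  obtain ⟨M, hM⟩ := isCompact_univ.exists_bound_of_continuousOn hf.continuousOn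
  exact ⟨M, fun x => hM x (Set.mem_univ x)⟩

lemma integrable_of_continuous (m : Measure P1) [IsFiniteMeasure m] {f : P1 → ℝ}
    (hf : Continuous f) : Integrable f m := by
  obtain ⟨M, hM⟩ := exists_abs_le_of_continuous hf
  exact Integrable.mono' (integrable_const M) hf.aestronglyMeasurable (.of_forall hM)

/-- The operator `f ↦ 2 (s (1 - s) f')'`: it is the Laplacian with respect to the Fubini-Study form
of functions of the squared chordal distance. -/
def chordLap (f : ℝ → ℝ) (t : ℝ) : ℝ :=
  2 * (t * (1 - t) * deriv (deriv f) t + (1 - 2 * t) * deriv f t)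

lemma continuous_chordLap {f : ℝ → ℝ} (hf : ContDiff ℝ ∞ f) : Continuous (chordLap f) := by
  have h1 := (contDiff_infty_iff_deriv.1 hf).2
  have c1 := h1.continuous
  have c2 := (contDiff_infty_iff_deriv.1 h1).2.continuous
  unfold chordLap
  fun_prop

lemma norm_sq_eq_re_im (x : ℂ) : ‖x‖ ^ 2 = x.re ^ 2 + x.im ^ 2 := by
  rw [← Complex.normSq_eq_norm_sq, Complex.normSq_apply]; ring

lemma laplacian_comp_chordSq {f : ℝ → ℝ} (hf : ContDiff ℝ ∞ f) (z : P1) (x : ℂ) :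
    Laplacian.laplacian ((fun y => f (chordSq z y)) ∘ chartZero) x =
      2 * Real.pi * (fsDensity x * chordLap f (chordSq z (chartZero x))) := by
  obtain ⟨A, B, b, c, hAB, hbc, h0, -⟩ := chordSq_chartZero_eq z
  have e : (fun y => f (chordSq z y)) ∘ chartZero = fun w => f (chordModel A B b c w) := by
    ext w; exact congrArg f (congrFun h0 w)
  have e' : chordSq z (chartZero x) = chordModel A B b c x := congrFun h0 x
  rw [e, e', laplacian_comp hf (contDiff_chordModel A B b c), laplacian_chordModel x hAB,
    norm_sq_pgrad_chordModel x hAB hbc, chordLap, fsDensity, norm_sq_eq_re_im]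
  have : 1 + (x.re ^ 2 + x.im ^ 2) ≠ 0 := by positivity
  have := Real.pi_ne_zero
  field_simp
  ring

/-- The squared gradient is f'(s)² s(1 - s) times 4π `fsDensity`, and s stays in [0, 1]; so it is
dominated by a multiple of an integrable density. -/
lemma memLp_pgrad_comp_chordSq {f : ℝ → ℝ} (hf : ContDiff ℝ ∞ f) (z : P1) :
    MemLp (pgrad ((fun y => f (chordSq z y)) ∘ chartZero)) 2 := by
  have hs : ContDiff ℝ ∞ ((fun y => f (chordSq z y)) ∘ chartZero) := (isSmooth_comp_chordSq hf z).1
  obtain ⟨A, B, b, c, hAB, hbc, h0, -⟩ := chordSq_chartZero_eq z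
  have e : (fun y => f (chordSq z y)) ∘ chartZero = fun w => f (chordModel A B b c w) := by
    ext w; exact congrArg f (congrFun h0 w)
  have hf' : Continuous (deriv f) := (contDiff_infty_iff_deriv.1 hf).2.continuous
  obtain ⟨C, hC⟩ := (isCompact_Icc (a := (0 : ℝ)) (b := 1)).exists_bound_of_continuousOn
    hf'.continuousOn
  rw [memLp_two_iff_integrable_sq_norm (continuous_pgrad hs).aestronglyMeasurable]
  refine Integrable.mono' (integrable_fsDensity.const_mul (C ^ 2 * (4 * Real.pi)))
    ((continuous_pgrad hs).norm.pow 2).aestronglyMeasurable (.of_forall fun x => ?_)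
  have e' : chordSq z (chartZero x) = chordModel A B b c x := congrFun h0 x
  have hm0 : 0 ≤ chordModel A B b c x := e' ▸ chordSq_nonneg _ _
  have hm1 : chordModel A B b c x ≤ 1 := e' ▸ chordSq_le_one _ _
  rw [Real.norm_eq_abs, abs_of_nonneg (by positivity), e,
    pgrad_comp (hf.differentiable (by simp)) ((contDiff_chordModel A B b c).differentiable (by simp)),
    norm_smul, mul_pow, norm_sq_pgrad_chordModel x hAB hbc]
  have h1 : ‖deriv f (chordModel A B b c x)‖ ^ 2 ≤ C ^ 2 :=
    pow_le_pow_left₀ (norm_nonneg _) (hC _ ⟨hm0, hm1⟩) 2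
  have h2 : 4 * Real.pi * fsDensity x = 4 / (1 + (x.re ^ 2 + x.im ^ 2)) ^ 2 := by
    rw [fsDensity, norm_sq_eq_re_im]
    have := Real.pi_ne_zero
    field_simp
  have h3 : chordModel A B b c x * (1 - chordModel A B b c x) ≤ 1 := by nlinarith
  rw [mul_assoc, h2]
  have h4 : 0 ≤ chordModel A B b c x * (1 - chordModel A B b c x) :=
    mul_nonneg hm0 (by linarith)
  refine mul_le_mul h1 ?_ (by positivity) (by positivity)
  exact mul_le_of_le_one_right (by positivity) h3

lemma integral_mul_chordLap_eq (u : P1 → ℝ) {f : ℝ → ℝ} (hf : ContDiff ℝ ∞ f) (z : P1) :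
    ∫ x, u x * chordLap f (chordSq z x) ∂fubiniStudy = (2 * Real.pi)⁻¹ *
      ∫ x : ℂ, u (chartZero x) * Laplacian.laplacian ((fun y => f (chordSq z y)) ∘ chartZero) x := by
  rw [integral_fubiniStudy, ← integral_const_mul]
  congr 1; ext x
  rw [laplacian_comp_chordSq hf]
  have := Real.pi_ne_zero
  field_simp

lemma integrable_laplacian_comp_chordSq {f : ℝ → ℝ} (hf : ContDiff ℝ ∞ f) (z : P1) :
    Integrable (Laplacian.laplacian ((fun y => f (chordSq z y)) ∘ chartZero)) := by
  obtain ⟨C, hC⟩ := exists_abs_le_of_continuous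
    ((continuous_chordLap hf).comp (continuous_chordSq z))
  refine Integrable.mono' (integrable_fsDensity.const_mul (2 * Real.pi * C))
    (continuous_laplacian (isSmooth_comp_chordSq hf z).1).aestronglyMeasurable
    (.of_forall fun x => ?_)
  rw [laplacian_comp_chordSq hf, Real.norm_eq_abs, abs_mul (2 * Real.pi),
    abs_of_pos Real.two_pi_pos, abs_mul, abs_of_nonneg (fsDensity_nonneg x)]
  have h1 := fsDensity_nonneg x
  have h2 := Real.pi_pos
  calc _ ≤ 2 * Real.pi * (fsDensity x * C) := by
        gcongr
        exact hC (chartZero x)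
    _ = _ := by ring

/-- Green's formula on the sphere for functions of chordal distances. -/
lemma integral_chordLap_comm {f₁ f₂ : ℝ → ℝ} (h₁ : ContDiff ℝ ∞ f₁) (h₂ : ContDiff ℝ ∞ f₂)
    (z₁ z₂ : P1) : ∫ x, f₁ (chordSq z₁ x) * chordLap f₂ (chordSq z₂ x) ∂fubiniStudy =
      ∫ x, f₂ (chordSq z₂ x) * chordLap f₁ (chordSq z₁ x) ∂fubiniStudy := by
  rw [integral_mul_chordLap_eq (fun x => f₁ (chordSq z₁ x)) h₂,
    integral_mul_chordLap_eq (fun x => f₂ (chordSq z₂ x)) h₁]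
  congr 1
  have key : ∀ {f₁ f₂ : ℝ → ℝ} (_ : ContDiff ℝ ∞ f₁) (_ : ContDiff ℝ ∞ f₂) (z₁ z₂ : P1),
      ∫ x : ℂ, f₁ (chordSq z₁ (chartZero x)) *
        Laplacian.laplacian ((fun y => f₂ (chordSq z₂ y)) ∘ chartZero) x =
      -∫ x, inner ℝ (pgrad ((fun y => f₁ (chordSq z₁ y)) ∘ chartZero) x)
        (pgrad ((fun y => f₂ (chordSq z₂ y)) ∘ chartZero) x) := by
    intro f₁ f₂ h₁ h₂ z₁ z₂
    obtain ⟨M, hM⟩ := exists_abs_le_of_continuous (isSmooth_comp_chordSq h₁ z₁).continuous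
    exact integral_mul_laplacian_eq (isSmooth_comp_chordSq h₁ z₁).1 (isSmooth_comp_chordSq h₂ z₂).1
      (fun x => hM (chartZero x)) (memLp_pgrad_comp_chordSq h₁ z₁) (memLp_pgrad_comp_chordSq h₂ z₂)
      (integrable_laplacian_comp_chordSq h₂ z₂)
  rw [key h₁ h₂, key h₂ h₁]
  congr 2; ext x
  exact real_inner_comm _ _

lemma integral_chordLap_eq_zero {f : ℝ → ℝ} (hf : ContDiff ℝ ∞ f) (z : P1) :
    ∫ x, chordLap f (chordSq z x) ∂fubiniStudy = 0 := by
  have := integral_chordLap_comm (contDiff_const (c := (1 : ℝ))) hf z z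
  simpa [chordLap] using this

/-- The Laplacian of s ^ (j + 1) has zero total integral, which gives the recursion (j + 2) m_{j+1}
= (j + 1) m_j for the moments. -/
lemma integral_chordSq_pow (z : P1) (j : ℕ) :
    ∫ x, chordSq z x ^ j ∂fubiniStudy = 1 / ((j : ℝ) + 1) := by
  induction j with
  | zero => simp
  | succ j ih =>
    have h := integral_chordLap_eq_zero (f := fun t => t ^ (j + 1)) (contDiff_id.pow _) z
    have e : ∀ t : ℝ, chordLap (fun t => t ^ (j + 1)) t =
        2 * ((j : ℝ) + 1) * (((j : ℝ) + 1) * t ^ j - ((j : ℝ) + 2) * t ^ (j + 1)) := by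
      intro t
      have d1 : deriv (fun t : ℝ => t ^ (j + 1)) = fun t => ((j : ℝ) + 1) * t ^ j := by
        ext t; simp
      rw [chordLap, d1]
      rcases j with _ | j
      · simp
      · simp; ring
    simp only [e] at h
    have c : ∀ k : ℕ, Integrable (fun x => chordSq z x ^ k) fubiniStudy := fun k =>
      integrable_of_continuous _ ((continuous_chordSq z).pow k)
    rw [integral_const_mul, integral_sub ((c j).const_mul _) ((c (j + 1)).const_mul _),
      integral_const_mul, integral_const_mul, ih] at h
    push_cast
    have hj : (j : ℝ) + 1 ≠ 0 := by positivity
    rw [mul_one_div_cancel hj, mul_eq_zero, or_iff_right (by positivity)] at h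
    rw [eq_div_iff (by positivity)]
    linarith

lemma integral_polynomial_chordSq (z : P1) (p : Polynomial ℝ) :
    ∫ x, p.eval (chordSq z x) ∂fubiniStudy = ∫ t in (0 : ℝ)..1, p.eval t := by
  simp only [Polynomial.eval_eq_sum_range]
  rw [integral_finsetSum, intervalIntegral.integral_finsetSum]
  · refine Finset.sum_congr rfl fun j _ => ?_
    rw [integral_const_mul, intervalIntegral.integral_const_mul, integral_chordSq_pow, integral_pow]
    simp
  · exact fun i _ => Continuous.intervalIntegrable (by fun_prop) _ _
  · exact fun i _ => integrable_of_continuous _ (((continuous_chordSq z).pow i).const_mul _)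

/-- Archimedes' theorem: the squared chordal distance to a point is uniformly distributed. -/
theorem integral_comp_chordSq (z : P1) {f : ℝ → ℝ} (hf : Continuous f) :
    ∫ x, f (chordSq z x) ∂fubiniStudy = ∫ t in (0 : ℝ)..1, f t := by
  refine eq_of_abs_sub_le_all fun ε hε => ?_
  obtain ⟨p, hp⟩ := exists_polynomial_near_of_continuousOn 0 1 f hf.continuousOn (ε / 2) (by positivity)
  have h1 : |(∫ x, p.eval (chordSq z x) ∂fubiniStudy) - ∫ x, f (chordSq z x) ∂fubiniStudy| ≤ ε / 2 := by
    have c1 : Continuous fun x => p.eval (chordSq z x) := p.continuous.comp (continuous_chordSq z)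
    have c2 : Continuous fun x => f (chordSq z x) := hf.comp (continuous_chordSq z)
    rw [← integral_sub (integrable_of_continuous _ c1) (integrable_of_continuous _ c2)]
    have := norm_integral_le_of_norm_le_const (μ := fubiniStudy)
      (f := fun x => p.eval (chordSq z x) - f (chordSq z x))
      (.of_forall fun x => (hp _ ⟨chordSq_nonneg z x, chordSq_le_one z x⟩).le)
    simpa using this
  have h2 : |(∫ t in (0 : ℝ)..1, p.eval t) - ∫ t in (0 : ℝ)..1, f t| ≤ ε / 2 := by
    rw [← intervalIntegral.integral_sub (p.continuous.intervalIntegrable _ _)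
      (hf.intervalIntegrable _ _)]
    have := intervalIntegral.norm_integral_le_of_norm_le_const (a := (0 : ℝ)) (b := 1)
      (f := fun t => p.eval t - f t) (C := ε / 2) fun t ht => by
        rw [Set.uIoc_of_le zero_le_one] at ht
        exact (hp t ⟨ht.1.le, ht.2⟩).le
    simpa using this
  rw [integral_polynomial_chordSq] at h1
  have a1 := abs_le.1 h1
  have a2 := abs_le.1 h2
  rw [abs_le]; constructor <;> linarith

/-! ### Regularised point masses and logarithmic potentials. -/

/-- The equation `μ = ω + dd^c g`, tested on smooth functions of the chordal distances. -/
def IsChordPotential (μ : Measure P1) (g : P1 → ℝ) : Prop :=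
  Continuous g ∧ ∀ f : ℝ → ℝ, ContDiff ℝ ∞ f → ∀ z : P1,
    ∫ x, f (chordSq z x) ∂μ =
      ∫ x, f (chordSq z x) ∂fubiniStudy + ∫ x, g x * chordLap f (chordSq z x) ∂fubiniStudy

lemma IsPotential.isChordPotential {μ : Measure P1} {g : P1 → ℝ} (h : IsPotential μ g) :
    IsChordPotential μ g := by
  refine ⟨h.1, fun f hf z => ?_⟩
  rw [h.2 _ (isSmooth_comp_chordSq hf z), integral_mul_chordLap_eq g hf]

/-- A smooth probability measure concentrated on the annulus `δ / 4 ≤ d(·, z)² ≤ δ`. -/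
def regDirac (δ : ℝ) (z : P1) : Measure P1 :=
  fubiniStudy.withDensity fun x => ENNReal.ofReal (deriv (stepFun δ) (chordSq z x))

lemma continuous_deriv_stepFun (δ : ℝ) : Continuous (deriv (stepFun δ)) :=
  (contDiff_infty_iff_deriv.1 (contDiff_stepFun δ)).2.continuous

section RegDirac

variable {δ : ℝ} (hδ : 0 < δ)

include hδ

lemma integral_regDirac (z : P1) (f : P1 → ℝ) : ∫ x, f x ∂(regDirac δ z) =
    ∫ x, f x * deriv (stepFun δ) (chordSq z x) ∂fubiniStudy := by
  rw [regDirac, integral_withDensity_eq_integral_toReal_smul]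
  · congr 1; ext x
    rw [ENNReal.toReal_ofReal (deriv_stepFun_nonneg hδ _), smul_eq_mul, mul_comm]
  · exact ((continuous_deriv_stepFun δ).comp (continuous_chordSq z)).measurable.ennreal_ofReal
  · simp

variable (hδ1 : δ ≤ 1 / 2)

include hδ1

lemma chordLap_regLog (t : ℝ) : chordLap (regLog δ) t = deriv (stepFun δ) t - 1 :=
  regLog_ode hδ hδ1 t

/-- The density minus 1 is the Laplacian of the regularised logarithm, so it has integral 0 against
ω. -/
lemma isProbabilityMeasure_regDirac (z : P1) : IsProbabilityMeasure (regDirac δ z) := by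
  have hc : Continuous fun x => deriv (stepFun δ) (chordSq z x) :=
    (continuous_deriv_stepFun δ).comp (continuous_chordSq z)
  have hi := integrable_of_continuous fubiniStudy hc
  have h1 : ∫ x, deriv (stepFun δ) (chordSq z x) ∂fubiniStudy = 1 := by
    have := integral_chordLap_eq_zero (contDiff_regLog hδ hδ1) z
    simp only [chordLap_regLog hδ hδ1] at this
    rw [integral_sub hi (integrable_const 1)] at this
    simp at this
    linarith
  constructor
  rw [regDirac, withDensity_apply _ MeasurableSet.univ, Measure.restrict_univ,
    ← ofReal_integral_eq_lintegral_ofReal hi (.of_forall fun x => deriv_stepFun_nonneg hδ _), h1,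
    ENNReal.ofReal_one]

lemma integral_regDirac_le {z : P1} {f : P1 → ℝ} (hf : Continuous f) {C : ℝ}
    (hC : ∀ x, δ / 4 ≤ chordSq z x → chordSq z x ≤ δ → f x ≤ C) :
    ∫ x, f x ∂(regDirac δ z) ≤ C := by
  have := isProbabilityMeasure_regDirac hδ hδ1 z
  have hc : Continuous fun x => deriv (stepFun δ) (chordSq z x) :=
    (continuous_deriv_stepFun δ).comp (continuous_chordSq z)
  have h1 : C = ∫ x, C ∂(regDirac δ z) := by simp
  rw [h1, integral_regDirac hδ, integral_regDirac hδ]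
  refine integral_mono (integrable_of_continuous _ (hf.mul hc))
    (integrable_of_continuous _ (continuous_const.mul hc)) fun x => ?_
  by_cases h0 : deriv (stepFun δ) (chordSq z x) = 0
  · simp [h0]
  · have h2 := mem_Icc_of_deriv_stepFun_ne_zero hδ h0
    exact mul_le_mul_of_nonneg_right (hC x h2.1 h2.2) (deriv_stepFun_nonneg hδ _)

lemma abs_integral_regDirac_sub_le {z : P1} {f : P1 → ℝ} (hf : Continuous f) {c η : ℝ}
    (hC : ∀ x, chordSq z x ≤ δ → |f x - c| ≤ η) :
    |∫ x, f x ∂(regDirac δ z) - c| ≤ η := by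
  have h1 := integral_regDirac_le hδ hδ1 hf (C := c + η) fun x _ hx => by
    linarith [(abs_le.1 (hC x hx)).2]
  have h2 := integral_regDirac_le hδ hδ1 hf.neg (C := -(c - η)) fun x _ hx => by
    simp only [Pi.neg_apply]
    linarith [(abs_le.1 (hC x hx)).1]
  simp only [Pi.neg_apply, integral_neg] at h2
  rw [abs_le]; constructor <;> linarith

/-- The equation of μ is tested on the regularised logarithm, whose Laplacian turns g into its
integral against `regDirac δ z` minus its integral against ω. -/
lemma IsChordPotential.integral_regLog {μ : Measure P1} {g : P1 → ℝ} (h : IsChordPotential μ g)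
    (z : P1) : ∫ x, regLog δ (chordSq z x) ∂μ =
      (∫ t in (0 : ℝ)..1, regLog δ t) + ∫ x, g x ∂(regDirac δ z) - ∫ x, g x ∂fubiniStudy := by
  have hT := contDiff_regLog hδ hδ1
  have hc : Continuous fun x => deriv (stepFun δ) (chordSq z x) :=
    (continuous_deriv_stepFun δ).comp (continuous_chordSq z)
  rw [h.2 _ hT z, integral_comp_chordSq z hT.continuous, integral_regDirac hδ, add_sub_assoc,
    ← integral_sub (f := fun x => g x * deriv (stepFun δ) (chordSq z x))
      (integrable_of_continuous _ (h.1.mul hc)) (integrable_of_continuous _ h.1)]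
  congr 2; ext x
  rw [chordLap_regLog hδ hδ1]; ring

/-- Green's formula for two chordal functions gives the equation on this restricted class of tests.
That is enough to apply `log_potential` to the smoothed masses themselves. -/
lemma isChordPotential_regDirac (w : P1) :
    IsChordPotential (regDirac δ w) (fun x => regLog δ (chordSq w x)) := by
  have hT := contDiff_regLog hδ hδ1
  refine ⟨hT.continuous.comp (continuous_chordSq w), fun f hf z => ?_⟩
  have hc : Continuous fun x => deriv (stepFun δ) (chordSq w x) :=
    (continuous_deriv_stepFun δ).comp (continuous_chordSq w)
  have hfc : Continuous fun x => f (chordSq z x) := hf.continuous.comp (continuous_chordSq z)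
  rw [integral_regDirac hδ, integral_chordLap_comm hT hf w z]
  simp only [chordLap_regLog hδ hδ1, mul_sub, mul_one]
  rw [integral_sub (f := fun x => f (chordSq z x) * deriv (stepFun δ) (chordSq w x))
    (integrable_of_continuous _ (hfc.mul hc)) (integrable_of_continuous _ hfc)]
  ring

end RegDirac

/-- The topology is that of the one-point compactification, so continuity has to be expressed
through the chordal distance. By compactness, d(y, ·)² has a positive minimum on the closed set
where g differs from g(y) by at least η. -/
lemma exists_chordSq_lt {g : P1 → ℝ} (hg : Continuous g) (y : P1) {η : ℝ} (hη : 0 < η) :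
    ∃ δ > 0, ∀ x, chordSq y x ≤ δ → |g x - g y| ≤ η := by
  by_contra! H
  have hK : IsCompact {x | η ≤ |g x - g y|} :=
    (isClosed_le continuous_const (by fun_prop)).isCompact
  obtain ⟨x₁, -, hx₁⟩ := H 1 one_pos
  obtain ⟨x₀, hx₀, hmin⟩ := hK.exists_isMinOn ⟨x₁, hx₁.le⟩ (continuous_chordSq y).continuousOn
  have hne : y ≠ x₀ := by
    rintro rfl
    simp at hx₀
    linarith
  obtain ⟨x, hx, hx'⟩ := H (chordSq y x₀ / 2) (half_pos (chordSq_pos hne))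
  have h1 : chordSq y x₀ ≤ chordSq y x := hmin (show x ∈ {x | η ≤ |g x - g y|} from hx'.le)
  linarith [chordSq_pos hne]

lemma measurable_log_sphDist (y : P1) : Measurable fun x => Real.log (sphDist x y) := by
  simp only [log_sphDist]
  exact (Real.measurable_log.comp (continuous_chordSq y).measurable).const_mul _

/-- The logarithmic potential of a probability measure with a continuous potential `g` differs from
`g` by a constant; in particular the measure has no atoms. -/
theorem IsChordPotential.log_potential {μ : Measure P1} [IsProbabilityMeasure μ] {g : P1 → ℝ}
    (h : IsChordPotential μ g) (y : P1) :
    μ {y} = 0 ∧ Integrable (fun x => Real.log (sphDist x y)) μ ∧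
      ∫ x, Real.log (sphDist x y) ∂μ = g y - 1 / 2 - ∫ x, g x ∂fubiniStudy := by
  set δ : ℕ → ℝ := fun k => 1 / 2 * (1 / ((k : ℝ) + 1)) with hδd
  have hδ : ∀ k, 0 < δ k := fun k => by positivity
  have hδ1 : ∀ k, δ k ≤ 1 / 2 := fun k => by
    have : 1 / ((k : ℝ) + 1) ≤ 1 := by
      rw [div_le_one (by positivity)]; linarith [k.cast_nonneg (α := ℝ)]
    simp only [hδd]; linarith
  have hδ0 : Filter.Tendsto δ Filter.atTop (nhds 0) := by
    simpa [hδd] using tendsto_one_div_add_atTop_nhds_zero_nat.const_mul (1 / 2 : ℝ)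
  set u : ℕ → P1 → ℝ := fun k x => regLog (δ k) (chordSq y x) with hu
  have huc : ∀ k, Continuous (u k) := fun k =>
    (contDiff_regLog (hδ k) (hδ1 k)).continuous.comp (continuous_chordSq y)
  have hu0 : ∀ k x, u k x ≤ 0 := fun k x =>
    regLog_nonpos (hδ k) (hδ1 k) (chordSq_nonneg _ _) (chordSq_le_one _ _)
  set c := g y - 1 / 2 - ∫ x, g x ∂fubiniStudy with hc
  have tu : Filter.Tendsto (fun k => ∫ x, u k x ∂μ) Filter.atTop (nhds c) := by
    have t1 : Filter.Tendsto (fun k => ∫ t in (0 : ℝ)..1, regLog (δ k) t) Filter.atTop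
        (nhds (-(1 / 2))) := by
      refine tendsto_of_tendsto_of_tendsto_of_le_of_le tendsto_const_nhds
        (h := fun k => -(1 / 2) + δ k) ?_ (fun k => (integral_regLog_mem (hδ k) (hδ1 k)).1)
        (fun k => (integral_regLog_mem (hδ k) (hδ1 k)).2)
      simpa only [add_zero] using hδ0.const_add (-(1 / 2))
    have t2 : Filter.Tendsto (fun k => ∫ x, g x ∂(regDirac (δ k) y)) Filter.atTop (nhds (g y)) := by
      rw [Metric.tendsto_atTop']
      intro η hη
      obtain ⟨d, hd, hgd⟩ := exists_chordSq_lt h.1 y (half_pos hη)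
      obtain ⟨N, hN⟩ := Filter.eventually_atTop.1 (hδ0.eventually_lt_const hd)
      refine ⟨N, fun k hk => ?_⟩
      rw [Real.dist_eq]
      refine (abs_integral_regDirac_sub_le (hδ k) (hδ1 k) h.1 fun x hx =>
        hgd x (hx.trans (hN k hk.le).le)).trans_lt (by linarith)
    have t3 := (t1.add t2).sub_const (∫ x, g x ∂fubiniStudy)
    have e : -(1 / 2) + g y - ∫ x, g x ∂fubiniStudy = c := by rw [hc]; ring
    rw [e] at t3
    exact t3.congr fun k => (h.integral_regLog (hδ k) (hδ1 k) y).symm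
  -- At y the regularised logarithms tend to -∞ while being nonpositive elsewhere; an atom would
  -- force their integrals to -∞, against the limit `tu`.
  have hatom : μ {y} = 0 := by
    by_contra hne
    have hpos : 0 < μ.real {y} := by
      rw [Measure.real]; exact ENNReal.toReal_pos hne (measure_ne_top _ _)
    have hle : ∀ k, ∫ x, u k x ∂μ ≤ (1 / 2 * Real.log (δ k) + 1 / 2) * μ.real {y} := by
      intro k
      have h1 : ∫ x, u k x ∂μ ≤ ∫ x in {y}, u k x ∂μ := by
        have := setIntegral_le_integral (s := {y}) (integrable_of_continuous μ (huc k).neg)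
          (.of_forall fun x => by simpa using hu0 k x)
        simp only [Pi.neg_apply, integral_neg] at this
        linarith
      have h2 : ∫ x in {y}, u k x ∂μ = μ.real {y} * u k y := by
        rw [integral_singleton]; simp
      have h3 : u k y ≤ 1 / 2 * Real.log (δ k) + 1 / 2 := by
        have e : chordSq y y = 0 := by simp [chordSq, sphDist_eq_zero_iff.2]
        have := regLog_le (hδ k) (hδ1 k) le_rfl (hδ k).le
        simp only [hu, e]
        linarith [neg_log_one_sub_le (hδ k) (hδ1 k)]
      rw [h2] at h1
      nlinarith
    have t1 : Filter.Tendsto (fun k => Real.log (δ k)) Filter.atTop Filter.atBot :=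
      Real.tendsto_log_nhdsNE_zero.comp (tendsto_nhdsWithin_iff.2
        ⟨hδ0, .of_forall fun k => (hδ k).ne'⟩)
    have t2 : Filter.Tendsto (fun k => (1 / 2 * Real.log (δ k) + 1 / 2) * μ.real {y})
        Filter.atTop Filter.atBot :=
      (Filter.tendsto_atBot_add_const_right _ _ (t1.const_mul_atBot (by norm_num))).atBot_mul_const hpos
    exact not_tendsto_nhds_of_tendsto_atBot (Filter.tendsto_atBot_mono hle t2) c tu
  have hae : ∀ᵐ x ∂μ, y ≠ x := by
    have : ∀ᵐ x ∂μ, x ∉ ({y} : Set P1) := measure_eq_zero_iff_ae_notMem.1 hatom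
    filter_upwards [this] with x hx
    exact fun e => hx e.symm
  have hlim : ∀ᵐ x ∂μ, Filter.Tendsto (fun k => u k x) Filter.atTop (nhds (Real.log (sphDist x y))) := by
    filter_upwards [hae] with x hx
    refine tendsto_const_nhds.congr' ?_
    filter_upwards [hδ0.eventually_lt_const (chordSq_pos hx)] with k hk
    rw [log_sphDist]
    exact (regLog_eq_log (hδ k) (hδ1 k) hk.le (chordSq_le_one _ _)).symm
  -- Fatou's lemma: the functions u_k are nonpositive and their integrals converge to a finite
  -- limit.
  have hint : Integrable (fun x => Real.log (sphDist x y)) μ := by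
    refine ⟨(measurable_log_sphDist y).aestronglyMeasurable, ?_⟩
    have h1 : ∫⁻ x, ‖Real.log (sphDist x y)‖ₑ ∂μ ≤
        Filter.liminf (fun k => ∫⁻ x, ‖u k x‖ₑ ∂μ) Filter.atTop := by
      refine le_trans (le_of_eq (lintegral_congr_ae ?_))
        (lintegral_liminf_le fun k => (huc k).enorm.measurable)
      filter_upwards [hlim] with x hx
      exact (hx.enorm.liminf_eq).symm
    have h2 : ∀ k, ∫⁻ x, ‖u k x‖ₑ ∂μ = ENNReal.ofReal (-∫ x, u k x ∂μ) := by
      intro k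
      rw [← integral_neg, ofReal_integral_eq_lintegral_ofReal (f := fun x => -u k x)
        (integrable_of_continuous μ (huc k)).neg (.of_forall fun x => by simpa using hu0 k x)]
      refine lintegral_congr fun x => ?_
      rw [← enorm_neg, Real.enorm_of_nonneg (by linarith [hu0 k x])]
    have h3 : Filter.liminf (fun k => ∫⁻ x, ‖u k x‖ₑ ∂μ) Filter.atTop = ENNReal.ofReal (-c) := by
      simp only [h2]
      exact ((ENNReal.continuous_ofReal.tendsto _).comp tu.neg).liminf_eq
    rw [HasFiniteIntegral]
    exact (h1.trans_eq h3).trans_lt ENNReal.ofReal_lt_top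
  refine ⟨hatom, hint, tendsto_nhds_unique ?_ tu⟩
  -- Off y one has log d ≤ u_k ≤ 0, so |log d| is a dominating function.
  refine tendsto_integral_of_dominated_convergence _
    (fun k => (huc k).aestronglyMeasurable) hint.norm (fun k => ?_) hlim
  filter_upwards [hae] with x hx
  rw [Real.norm_eq_abs, Real.norm_eq_abs, abs_of_nonpos (hu0 k x), log_sphDist, abs_of_nonpos]
  · have := log_le_regLog (hδ k) (hδ1 k) (chordSq_pos hx) (chordSq_le_one _ _)
    simp only [hu]; linarith
  · have := Real.log_nonpos (chordSq_nonneg y x) (chordSq_le_one _ _)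
    linarith

/-- By `log_potential` the integral of Φ_g(x, ·) against μ does not depend on x; the normalisation
says that this constant is 0. -/
lemma IsGoodPotential.integral_eq {μ : Measure P1} [IsProbabilityMeasure μ] {g : P1 → ℝ}
    (h : IsGoodPotential μ g) : ∫ x, g x ∂μ = -(1 / 2) - ∫ x, g x ∂fubiniStudy := by
  obtain ⟨hp, hi, h0⟩ := h
  have hc := hp.isChordPotential
  have ig := integrable_of_continuous μ hp.1
  rw [integral_prod _ hi] at h0
  have inner : ∀ x, ∫ y, hsiaKernel g x y ∂μ =
      -(1 / 2) - ∫ x, g x ∂fubiniStudy - ∫ x, g x ∂μ := by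
    intro x
    obtain ⟨-, h1, h2⟩ := hc.log_potential x
    simp only [hsiaKernel, sphDist_comm x]
    rw [integral_sub (f := fun y => Real.log (sphDist y x) - g x) (h1.sub (integrable_const _)) ig,
      integral_sub h1 (integrable_const _), h2]
    simp
    ring
  simp only [inner] at h0
  simp at h0
  linarith

section RegDirac

variable {δ : ℝ} (hδ : 0 < δ) (hδ1 : δ ≤ 1 / 2)

include hδ hδ1

/-- One regularisation is removed using log ≤ `regLog`. Then `log_potential` for `regDirac δ w`
evaluates the integral of log d(·, z) as `regLog δ (chordSq w z)` up to the constant -1/2 minus its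
mean, which is at least -δ. -/
lemma log_sphDist_le_integral_regLog {z w : P1} (hzw : z ≠ w) :
    Real.log (sphDist z w) - δ ≤ ∫ x, regLog δ (chordSq z x) ∂(regDirac δ w) := by
  have := isProbabilityMeasure_regDirac hδ hδ1 w
  have hT := (contDiff_regLog hδ hδ1).continuous
  obtain ⟨h0, h1, h2⟩ := (isChordPotential_regDirac hδ hδ1 w).log_potential z
  have h3 : ∫ x, Real.log (sphDist x z) ∂(regDirac δ w) ≤
      ∫ x, regLog δ (chordSq z x) ∂(regDirac δ w) := by
    refine integral_mono_ae h1 (integrable_of_continuous _ (hT.comp (continuous_chordSq z))) ?_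
    filter_upwards [measure_eq_zero_iff_ae_notMem.1 h0] with x hx
    rw [log_sphDist]
    exact log_le_regLog hδ hδ1 (chordSq_pos fun e => hx e.symm) (chordSq_le_one _ _)
  have h4 : Real.log (sphDist z w) ≤ regLog δ (chordSq w z) := by
    rw [log_sphDist]
    exact log_le_regLog hδ hδ1 (chordSq_pos hzw.symm) (chordSq_le_one _ _)
  rw [integral_comp_chordSq w hT] at h2
  linarith [(integral_regLog_mem hδ hδ1).2]

/-- The smoothed mass lives where d² ≥ δ/4, and there the regularised logarithm is at least (1/2)
log(δ/4). This is why the step starts away from 0. -/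
lemma log_le_integral_regLog_self (z : P1) :
    1 / 2 * Real.log δ - Real.log 2 ≤ ∫ x, regLog δ (chordSq z x) ∂(regDirac δ z) := by
  have hT := (contDiff_regLog hδ hδ1).continuous.comp (continuous_chordSq z)
  have := integral_regDirac_le hδ hδ1 (z := z) hT.neg
    (C := -(1 / 2 * Real.log δ - Real.log 2)) fun x hx _ => by
      have h0 : 0 < chordSq z x := lt_of_lt_of_le (by positivity) hx
      have h1 := log_le_regLog hδ hδ1 h0 (chordSq_le_one _ _)
      have h2 := Real.log_le_log (by positivity) hx
      have h3 : Real.log (δ / 4) = Real.log δ - 2 * Real.log 2 := by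
        rw [Real.log_div hδ.ne' (by norm_num), show (4 : ℝ) = 2 ^ 2 by norm_num, Real.log_pow]
        norm_num
      simp only [Pi.neg_apply, Function.comp]
      linarith
  simp only [Pi.neg_apply, Function.comp, integral_neg] at this
  linarith

end RegDirac

/-! ### Passage to the affine plane and the regularised empirical measure. -/

/-- Extension by zero at infinity. -/
def extendZero (ψ : ℂ → ℝ) (x : P1) : ℝ := x.elim 0 ψ

lemma extendZero_chartZero (ψ : ℂ → ℝ) (z : ℂ) : extendZero ψ (chartZero z) = ψ z := rfl

lemma isSmooth_extendZero {ψ : ℂ → ℝ} (hψ : ContDiff ℝ ∞ ψ) (hc : HasCompactSupport ψ) :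
    IsSmooth (extendZero ψ) := by
  refine ⟨hψ, ?_⟩
  have e : ∀ w : ℂ, w ≠ 0 → (extendZero ψ ∘ chartInfty) w = ψ w⁻¹ := by
    intro w hw
    simp only [Function.comp, chartInfty, if_neg hw]
    rfl
  rw [contDiff_iff_contDiffAt]
  intro w
  by_cases hw : w = 0
  · subst hw
    obtain ⟨R, hR0, hR⟩ := hc.isCompact.isBounded.subset_closedBall_lt 0 (0 : ℂ)
    refine (contDiffAt_const (c := (0 : ℝ))).congr_of_eventuallyEq ?_
    filter_upwards [Metric.ball_mem_nhds (0 : ℂ) (inv_pos.2 hR0)] with w hw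
    by_cases h0 : w = 0
    · subst h0
      simp [chartInfty, extendZero]
    · rw [e w h0]
      by_contra hne
      have h1 := hR (subset_tsupport _ hne)
      rw [mem_closedBall_zero_iff, norm_inv] at h1
      rw [mem_ball_zero_iff] at hw
      have h2 := inv_strictAnti₀ (norm_pos_iff.2 h0) hw
      rw [inv_inv] at h2
      linarith
  · refine ContDiffAt.congr_of_eventuallyEq (f := fun w => ψ w⁻¹) ?_ ?_
    · exact hψ.contDiffAt.comp w (contDiffAt_inv ℝ hw)
    · filter_upwards [isOpen_ne.mem_nhds hw] with v hv using e v hv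

/-- The restriction of a measure on the sphere to the affine chart. -/
def planeMeasure (μ : Measure P1) : Measure ℂ := μ.comap chartZero

instance isFiniteMeasure_planeMeasure (μ : Measure P1) [IsFiniteMeasure μ] :
    IsFiniteMeasure (planeMeasure μ) := by
  constructor
  rw [planeMeasure, measurableEmbedding_chartZero.comap_apply]
  exact measure_lt_top _ _

lemma integral_planeMeasure {μ : Measure P1} (h : μ {OnePoint.infty} = 0) (f : P1 → ℝ) :
    ∫ z, f (chartZero z) ∂(planeMeasure μ) = ∫ x, f x ∂μ := by
  rw [← measurableEmbedding_chartZero.integral_map, planeMeasure,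
    measurableEmbedding_chartZero.map_comap, Measure.restrict_eq_self_of_ae_mem]
  filter_upwards [measure_eq_zero_iff_ae_notMem.1 h] with x hx
  induction x using OnePoint.rec with
  | infty => exact absurd rfl hx
  | coe z => exact ⟨z, rfl⟩

lemma hasCompactSupport_laplacian {ψ : ℂ → ℝ} (hψ : ContDiff ℝ ∞ ψ) (hc : HasCompactSupport ψ) :
    HasCompactSupport (Laplacian.laplacian ψ) := by
  rw [show Laplacian.laplacian ψ = _ from funext (laplacian_eq hψ)]
  exact ((hc.fderiv_apply (𝕜 := ℝ) 1).fderiv_apply (𝕜 := ℝ) 1).add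
    ((hc.fderiv_apply (𝕜 := ℝ) Complex.I).fderiv_apply (𝕜 := ℝ) Complex.I)

/-- Green's formula is used in both directions between ψ and the regularised logarithm. Here ψ is an
arbitrary test function of the plane, so the version for two chordal functions does not suffice. -/
lemma integral_regLog_mul_laplacian {δ : ℝ} (hδ : 0 < δ) (hδ1 : δ ≤ 1 / 2) (z : P1) {ψ : ℂ → ℝ}
    (hψ : ContDiff ℝ ∞ ψ) (hc : HasCompactSupport ψ) :
    ∫ x : ℂ, regLog δ (chordSq z (chartZero x)) * Laplacian.laplacian ψ x = 2 * Real.pi *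
      (∫ x, extendZero ψ x ∂(regDirac δ z) - ∫ x, extendZero ψ x ∂fubiniStudy) := by
  have hT := contDiff_regLog hδ hδ1
  have hu : ContDiff ℝ ∞ ((fun y => regLog δ (chordSq z y)) ∘ chartZero) :=
    (isSmooth_comp_chordSq hT z).1
  have hcont := (isSmooth_extendZero hψ hc).continuous
  obtain ⟨M, hM⟩ := exists_abs_le_of_continuous (isSmooth_comp_chordSq hT z).continuous
  obtain ⟨M', hM'⟩ := exists_abs_le_of_continuous hcont
  have gψ := memLp_norm_pgrad_of_hasCompactSupport hψ hc
  have gu := memLp_pgrad_comp_chordSq hT z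
  have iψ : Integrable (Laplacian.laplacian ψ) :=
    (continuous_laplacian hψ).integrable_of_hasCompactSupport (hasCompactSupport_laplacian hψ hc)
  have e1 := integral_mul_laplacian_eq hu hψ (fun x => hM (chartZero x)) gu gψ iψ
  have e2 := integral_mul_laplacian_eq hψ hu (fun x => hM' (chartZero x)) gψ gu
    (integrable_laplacian_comp_chordSq hT z)
  have e3 := integral_mul_chordLap_eq (extendZero ψ) hT z
  have hd : Continuous fun x => deriv (stepFun δ) (chordSq z x) :=
    (continuous_deriv_stepFun δ).comp (continuous_chordSq z)
  have e4 : ∫ x, extendZero ψ x * chordLap (regLog δ) (chordSq z x) ∂fubiniStudy =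
      ∫ x, extendZero ψ x ∂(regDirac δ z) - ∫ x, extendZero ψ x ∂fubiniStudy := by
    rw [integral_regDirac hδ,
      ← integral_sub (f := fun x => extendZero ψ x * deriv (stepFun δ) (chordSq z x))
      (integrable_of_continuous _ (hcont.mul hd)) (integrable_of_continuous _ hcont)]
    congr 1; ext x
    rw [chordLap_regLog hδ hδ1]; ring
  simp only [extendZero_chartZero] at e3
  rw [← e4, e3, e2, mul_inv_cancel_left₀ Real.two_pi_pos.ne']
  refine e1.trans ?_
  congr 2; ext x
  exact real_inner_comm _ _

/-- The regularised empirical measure of `F`. -/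
def regEmpirical (δ : ℝ) (F : Finset P1) : Measure P1 :=
  (F.card : ENNReal)⁻¹ • ∑ z ∈ F, regDirac δ z

/-- The potential of `regEmpirical δ F`. -/
def regEmpiricalPotential (δ : ℝ) (F : Finset P1) (x : P1) : ℝ :=
  (F.card : ℝ)⁻¹ * ∑ z ∈ F, regLog δ (chordSq z x)

section Empirical

variable {δ : ℝ} (hδ : 0 < δ) (hδ1 : δ ≤ 1 / 2) {F : Finset P1} (hF : F.Nonempty)

include hδ hδ1

lemma continuous_regEmpiricalPotential : Continuous (regEmpiricalPotential δ F) :=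
  continuous_const.mul (continuous_finsetSum _ fun z _ =>
    (contDiff_regLog hδ hδ1).continuous.comp (continuous_chordSq z))

include hF

lemma isFiniteMeasure_regEmpirical : IsFiniteMeasure (regEmpirical δ F) := by
  have : ∀ z, IsProbabilityMeasure (regDirac δ z) := isProbabilityMeasure_regDirac hδ hδ1
  have hs : (∑ z ∈ F, regDirac δ z) Set.univ < ⊤ := by
    rw [Measure.finsetSum_apply, ENNReal.sum_lt_top]
    exact fun z _ => measure_lt_top _ _
  constructor
  rw [regEmpirical, Measure.smul_apply, smul_eq_mul]
  refine ENNReal.mul_lt_top ?_ hs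
  rw [ENNReal.inv_lt_top]
  exact_mod_cast hF.card_pos

omit hF in
lemma integral_regEmpirical {f : P1 → ℝ} (hf : Continuous f) :
    ∫ x, f x ∂(regEmpirical δ F) = (F.card : ℝ)⁻¹ * ∑ z ∈ F, ∫ x, f x ∂(regDirac δ z) := by
  have : ∀ z, IsProbabilityMeasure (regDirac δ z) := isProbabilityMeasure_regDirac hδ hδ1
  rw [regEmpirical, integral_smul_measure, integral_finsetSum_measure fun z _ =>
    integrable_of_continuous _ hf]
  simp

omit hF in
lemma regEmpirical_singleton (y : P1) : regEmpirical δ F {y} = 0 := by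
  rw [regEmpirical, Measure.smul_apply, Measure.finsetSum_apply, smul_eq_mul,
    Finset.sum_eq_zero, mul_zero]
  intro z _
  have := isProbabilityMeasure_regDirac hδ hδ1 z
  exact ((isChordPotential_regDirac hδ hδ1 z).log_potential y).1

/-- Both potentials are taken relative to ω, so ω cancels in the difference. Neither measure charges
infinity, so nothing is lost in the affine chart. -/
lemma isPoissonSolution_regEmpirical {μ : Measure P1} [IsProbabilityMeasure μ] {g : P1 → ℝ}
    (hg : IsPotential μ g) :
    IsPoissonSolution (fun z => regEmpiricalPotential δ F (chartZero z) - g (chartZero z))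
      (planeMeasure (regEmpirical δ F)) (planeMeasure μ) := by
  intro ψ hψ hc
  have hcont := (isSmooth_extendZero hψ hc).continuous
  have hT := (contDiff_regLog hδ hδ1).continuous
  have hz : Continuous chartZero := OnePoint.continuous_coe
  have cΔ := continuous_laplacian hψ
  have sΔ := hasCompactSupport_laplacian hψ hc
  have hi : ∀ f : P1 → ℝ, Continuous f →
      Integrable (fun x => f (chartZero x) * Laplacian.laplacian ψ x) := fun f hf =>
    ((hf.comp hz).mul cΔ).integrable_of_hasCompactSupport sΔ.mul_left
  have e1 := integral_planeMeasure (hg.isChordPotential.log_potential OnePoint.infty).1 (extendZero ψ)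
  have e2 := integral_planeMeasure (regEmpirical_singleton (F := F) hδ hδ1 OnePoint.infty)
    (extendZero ψ)
  simp only [extendZero_chartZero] at e1 e2
  have e3 := hg.2 _ (isSmooth_extendZero hψ hc)
  have e3' : ∫ z : ℂ, g (chartZero z) * Laplacian.laplacian ψ z =
      2 * Real.pi * (∫ x, extendZero ψ x ∂μ - ∫ x, extendZero ψ x ∂fubiniStudy) := by
    rw [e3, add_sub_cancel_left, mul_inv_cancel_left₀ Real.two_pi_pos.ne']
    rfl
  have hn : (F.card : ℝ) ≠ 0 := by exact_mod_cast hF.card_pos.ne'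
  rw [e1, e2, integral_regEmpirical hδ hδ1 hcont]
  simp only [sub_mul]
  rw [integral_sub (hi _ (continuous_regEmpiricalPotential hδ hδ1)) (hi _ hg.1), e3']
  simp only [regEmpiricalPotential, mul_assoc, Finset.sum_mul]
  rw [integral_const_mul, integral_finsetSum _ fun z _ =>
      hi (fun x => regLog δ (chordSq z x)) (hT.comp (continuous_chordSq z)),
    Finset.sum_congr rfl fun z _ => integral_regLog_mul_laplacian hδ hδ1 z hψ hc,
    ← Finset.mul_sum, Finset.sum_sub_distrib, Finset.sum_const, nsmul_eq_mul]
  field_simp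
  ring

-- The double sum splits into pairs of distinct points, bounded through `log_potential`, and the n
-- self-energies, finite only because of the smoothing.
open scoped Classical in
omit hF in
lemma sum_log_sphDist_le : (∑ p ∈ F.offDiag, (Real.log (sphDist p.1 p.2) - δ)) +
      F.card * (1 / 2 * Real.log δ - Real.log 2) ≤
    ∑ w ∈ F, ∑ z ∈ F, ∫ x, regLog δ (chordSq z x) ∂(regDirac δ w) := by
  rw [Finset.sum_comm, ← Finset.sum_product', ← Finset.diag_union_offDiag,
    Finset.sum_union (Finset.disjoint_diag_offDiag F), Finset.sum_diag, add_comm]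
  refine add_le_add ?_ (Finset.sum_le_sum fun p hp => ?_)
  · rw [← nsmul_eq_mul, ← Finset.sum_const]
    exact Finset.sum_le_sum fun z _ => log_le_integral_regLog_self hδ hδ1 z
  · exact log_sphDist_le_integral_regLog hδ hδ1 (Finset.mem_offDiag.1 hp).2.2

-- Since ∫ U dμ equals ∫ g dν - ∫ g dω plus the mean of the regularised logarithm, inserting ∫ g dμ
-- = -1/2 - ∫ g dω removes ω. What remains is 2 ∫ g dν - ∫ U dν plus an error of at most δ.
open scoped Classical in
lemma energy_le {μ : Measure P1} [IsProbabilityMeasure μ] {g : P1 → ℝ} (hg : IsGoodPotential μ g)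
    {η : ℝ} (hη : ∀ z x, chordSq z x ≤ δ → |g x - g z| ≤ η) :
    (∫ x, (regEmpiricalPotential δ F x - g x) ∂μ) -
      ∫ x, (regEmpiricalPotential δ F x - g x) ∂(regEmpirical δ F) ≤
    2 * ((F.card : ℝ)⁻¹ * ∑ z ∈ F, g z + η) + δ - ((F.card : ℝ)⁻¹) ^ 2 *
      ((∑ p ∈ F.offDiag, (Real.log (sphDist p.1 p.2) - δ)) +
      F.card * (1 / 2 * Real.log δ - Real.log 2)) := by
  have := isFiniteMeasure_regEmpirical hδ hδ1 hF
  have hT := (contDiff_regLog hδ hδ1).continuous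
  have hn : (F.card : ℝ) ≠ 0 := by exact_mod_cast hF.card_pos.ne'
  have hn0 : (0 : ℝ) < F.card := by exact_mod_cast hF.card_pos
  have hU := continuous_regEmpiricalPotential (F := F) hδ hδ1
  have hgc := hg.1.1
  have hTi : ∀ z, Continuous fun x => regLog δ (chordSq z x) := fun z =>
    hT.comp (continuous_chordSq z)
  rw [integral_sub (integrable_of_continuous _ hU) (integrable_of_continuous _ hgc),
    integral_sub (integrable_of_continuous _ hU) (integrable_of_continuous _ hgc)]
  have e1 : ∫ x, regEmpiricalPotential δ F x ∂μ = (∫ t in (0 : ℝ)..1, regLog δ t) +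
      ∫ x, g x ∂(regEmpirical δ F) - ∫ x, g x ∂fubiniStudy := by
    simp only [regEmpiricalPotential]
    rw [integral_const_mul, integral_finsetSum _ fun z _ => integrable_of_continuous _ (hTi z),
      Finset.sum_congr rfl fun z _ => hg.1.isChordPotential.integral_regLog hδ hδ1 z,
      integral_regEmpirical hδ hδ1 hgc, Finset.sum_sub_distrib, Finset.sum_add_distrib,
      Finset.sum_const, Finset.sum_const, nsmul_eq_mul, nsmul_eq_mul]
    field_simp
  have e2 : ∫ x, regEmpiricalPotential δ F x ∂(regEmpirical δ F) = ((F.card : ℝ)⁻¹) ^ 2 *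
      ∑ w ∈ F, ∑ z ∈ F, ∫ x, regLog δ (chordSq z x) ∂(regDirac δ w) := by
    rw [integral_regEmpirical hδ hδ1 hU, pow_two, mul_assoc]
    congr 1
    rw [Finset.mul_sum]
    refine Finset.sum_congr rfl fun w _ => ?_
    have := isProbabilityMeasure_regDirac hδ hδ1 w
    simp only [regEmpiricalPotential]
    rw [integral_const_mul, integral_finsetSum _ fun z _ => integrable_of_continuous _ (hTi z)]
  have e3 : ∫ x, g x ∂(regEmpirical δ F) ≤ (F.card : ℝ)⁻¹ * ∑ z ∈ F, g z + η := by
    rw [integral_regEmpirical hδ hδ1 hgc]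
    have : ∑ z ∈ F, ∫ x, g x ∂(regDirac δ z) ≤ ∑ z ∈ F, (g z + η) := by
      refine Finset.sum_le_sum fun z _ => integral_regDirac_le hδ hδ1 hgc fun x _ hx => ?_
      linarith [(abs_le.1 (hη z x hx)).2]
    rw [Finset.sum_add_distrib, Finset.sum_const, nsmul_eq_mul] at this
    calc _ ≤ (F.card : ℝ)⁻¹ * (∑ z ∈ F, g z + F.card * η) := by gcongr
      _ = _ := by field_simp
  have e4 := mul_le_mul_of_nonneg_left (sum_log_sphDist_le (F := F) hδ hδ1)
    (show 0 ≤ ((F.card : ℝ)⁻¹) ^ 2 by positivity)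
  rw [e1, e2]
  linarith [hg.integral_eq, (integral_regLog_mem hδ hδ1).2]

end Empirical

/-! ### Hölder and continuity bounds, and the final estimate. -/

lemma uniformContinuous_comp_chartZero {h : P1 → ℝ} (hh : Continuous h) :
    UniformContinuous (fun z => h (chartZero z)) := by
  obtain ⟨h1, h2⟩ := (OnePoint.continuous_iff h).1 hh
  rw [Filter.coclosedCompact_eq_cocompact] at h1
  exact Continuous.uniformContinuous_of_tendsto_cocompact h2 h1

/-- Without boundedness `sSup` would take a default value and `holderSeminorm` would bound nothing.
-/
lemma IsHolder.bddAbove {α : ℝ} {g : P1 → ℝ} (h : IsHolder α g) :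
    BddAbove {r : ℝ | ∃ x y : P1, x ≠ y ∧ r = |g x - g y| / sphDist x y ^ α} := by
  obtain ⟨C, -, hC⟩ := h
  refine ⟨C, ?_⟩
  rintro r ⟨x, y, hxy, rfl⟩
  rw [div_le_iff₀ (Real.rpow_pos_of_pos (sphDist_pos hxy) _)]
  exact hC x y

lemma holderSeminorm_nonneg (α : ℝ) (g : P1 → ℝ) : 0 ≤ holderSeminorm α g := by
  refine Real.sSup_nonneg ?_
  rintro r ⟨x, y, -, rfl⟩
  have := Real.rpow_nonneg (sphDist_nonneg x y) α
  positivity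

lemma IsHolder.abs_sub_le {α : ℝ} {g : P1 → ℝ} (h : IsHolder α g) (hα : 0 < α) {x y : P1} {ε : ℝ}
    (hxy : sphDist x y ≤ ε) : |g x - g y| ≤ holderSeminorm α g * ε ^ α := by
  have hS := holderSeminorm_nonneg α g
  have hε := (sphDist_nonneg x y).trans hxy
  rcases eq_or_ne x y with rfl | hne
  · simp only [sub_self, abs_zero]
    exact mul_nonneg hS (Real.rpow_nonneg hε _)
  · have h1 : |g x - g y| / sphDist x y ^ α ≤ holderSeminorm α g :=
      le_csSup h.bddAbove ⟨x, y, hne, rfl⟩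
    rw [div_le_iff₀ (Real.rpow_pos_of_pos (sphDist_pos hne) _)] at h1
    refine h1.trans (mul_le_mul_of_nonneg_left ?_ hS)
    exact Real.rpow_le_rpow (sphDist_nonneg _ _) hxy hα.le

lemma abs_sub_le_modulus {φ : P1 → ℝ} (hφ : Continuous φ) {x y : P1} {ε : ℝ}
    (hxy : sphDist x y ≤ ε) : |φ x - φ y| ≤ modulus φ ε := by
  obtain ⟨M, hM⟩ := exists_abs_le_of_continuous hφ
  refine le_csSup ⟨2 * M, ?_⟩ ⟨x, y, hxy, rfl⟩
  rintro r ⟨x, y, -, rfl⟩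
  have h1 := abs_le.1 (hM x)
  have h2 := abs_le.1 (hM y)
  rw [abs_le]; constructor <;> linarith

-- Each point of `F` occurs in 2(n - 1) ordered pairs of distinct points.
open scoped Classical in
lemma sum_hsiaKernel (g : P1 → ℝ) (F : Finset P1) :
    ∑ p ∈ F.offDiag, hsiaKernel g p.1 p.2 =
      (∑ p ∈ F.offDiag, Real.log (sphDist p.1 p.2)) - 2 * ((F.card : ℝ) - 1) * ∑ z ∈ F, g z := by
  have h1 : ∑ p ∈ F.offDiag, (g p.1 + g p.2) = 2 * ((F.card : ℝ) - 1) * ∑ z ∈ F, g z := by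
    have h2 : ∑ p ∈ F ×ˢ F, (g p.1 + g p.2) = 2 * F.card * ∑ z ∈ F, g z := by
      rw [Finset.sum_product]
      simp only [Finset.sum_add_distrib, Finset.sum_const, nsmul_eq_mul]
      rw [← Finset.mul_sum]; ring
    rw [← Finset.diag_union_offDiag, Finset.sum_union (Finset.disjoint_diag_offDiag F),
      Finset.sum_diag, Finset.sum_add_distrib] at h2
    linarith
  rw [← h1, ← Finset.sum_sub_distrib]
  refine Finset.sum_congr rfl fun p _ => ?_
  rw [hsiaKernel]; ring

/-- Quantitative equidistribution of a finite set towards a measure with a Hölder potential. -/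
theorem IsHolder.equidistribution_estimate {α : ℝ} (hα0 : 0 < α) {μ : Measure P1} [IsProbabilityMeasure μ]
    {g : P1 → ℝ} (hg : IsGoodPotential μ g) (hgα : IsHolder α g) {φ : P1 → ℝ} (hφ : Continuous φ)
    (hφW : MemW12 φ) {F : Finset P1} (hF : 2 ≤ F.card) :
    0 ≤ constA α g F ∧ |∫ x, φ x ∂μ - (1 / (F.card : ℝ)) * ∑ z ∈ F, φ z| ≤
      modulus φ (1 / (F.card : ℝ) ^ max 2 (1 / α)) +
        constA α g F ^ (1 / 2 : ℝ) * gradNorm φ := by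
  classical
  set n : ℝ := (F.card : ℝ) with hn
  have hn2 : (2 : ℝ) ≤ n := by rw [hn]; exact_mod_cast hF
  have hn0 : 0 < n := by linarith
  have hFne : F.Nonempty := Finset.card_pos.1 (by omega)
  set τ : ℝ := max 2 (1 / α) with hτ
  have hτ2 : 2 ≤ τ := le_max_left _ _
  set ε : ℝ := 1 / n ^ τ with hε
  have hnτ : n ^ 2 ≤ n ^ τ := by
    rw [← Real.rpow_natCast]
    exact Real.rpow_le_rpow_of_exponent_le (by linarith) (by exact_mod_cast hτ2)
  have hnτ0 : 0 < n ^ τ := by positivity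
  have hε0 : 0 < ε := by positivity
  have hεn : ε ≤ 1 / n ^ 2 := one_div_le_one_div_of_le (by positivity) hnτ
  have hεα : ε ^ α ≤ 1 / n := by
    -- The exponent τ ≥ 1/α makes the Hölder error at scale ε at most 1/n; the other requirement, τ
    -- ≥ 2, gives ε ≤ 1/n² and so makes δ negligible.
    have h1 : n ≤ (n ^ τ) ^ α := by
      rw [← Real.rpow_mul hn0.le]
      calc n = n ^ (1 : ℝ) := (Real.rpow_one n).symm
        _ ≤ n ^ (τ * α) := by
          apply Real.rpow_le_rpow_of_exponent_le (by linarith)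
          have := mul_le_mul_of_nonneg_right (le_max_right 2 (1 / α)) hα0.le
          rwa [one_div_mul_cancel hα0.ne'] at this
    rw [hε, Real.div_rpow zero_le_one hnτ0.le, Real.one_rpow]
    exact one_div_le_one_div_of_le hn0 h1
  -- The regularisation parameter measures squared distances, hence the square of ε.
  set δ : ℝ := ε ^ 2 with hδe
  have hδ : 0 < δ := by positivity
  have hδn : δ ≤ 1 / n ^ 4 := by
    calc δ ≤ (1 / n ^ 2) ^ 2 := pow_le_pow_left₀ hε0.le hεn 2
      _ = 1 / n ^ 4 := by rw [div_pow, ← pow_mul, one_pow]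
  have hn8 : 8 ≤ n ^ 3 := by
    calc (8 : ℝ) = 2 ^ 3 := by norm_num
      _ ≤ n ^ 3 := pow_le_pow_left₀ (by norm_num) hn2 3
  have hδn' : δ * n ≤ 1 / 8 := by
    calc δ * n ≤ 1 / n ^ 4 * n := by gcongr
      _ = 1 / n ^ 3 := by field_simp
      _ ≤ 1 / 8 := one_div_le_one_div_of_le (by norm_num) hn8
  have hδ1 : δ ≤ 1 / 2 := by nlinarith
  have hdist : ∀ z x, chordSq z x ≤ δ → sphDist x z ≤ ε := fun z x hx =>
    (sq_le_sq₀ (sphDist_nonneg _ _) hε0.le).1 hx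
  set L := Real.log n with hL
  have hL2 : Real.log 2 ≤ L := Real.log_le_log (by norm_num) hn2
  have hlogδ : 1 / 2 * Real.log δ = -(τ * L) := by
    rw [hδe, Real.log_pow, hε, one_div (n ^ τ), Real.log_inv, Real.log_rpow hn0]
    push_cast; ring
  set S := ∑ p ∈ F.offDiag, Real.log (sphDist p.1 p.2) with hS
  set Γ := ∑ z ∈ F, g z with hΓ
  set K := holderSeminorm α g with hK
  have hK0 : 0 ≤ K := holderSeminorm_nonneg α g
  have hS0 : S ≤ 0 := Finset.sum_nonpos fun p _ =>
    Real.log_nonpos (sphDist_nonneg _ _) (sphDist_le_one _ _)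
  set h : P1 → ℝ := fun x => regEmpiricalPotential δ F x - g x with hh
  have hhc : Continuous h := (continuous_regEmpiricalPotential hδ hδ1).sub hg.1.1
  set E := (∫ x, h x ∂μ) - ∫ x, h x ∂(regEmpirical δ F) with hE
  have hEle : E ≤ constA α g F := by
    have h1 := energy_le hδ hδ1 hFne hg (η := K * ε ^ α) fun z x hx =>
      hgα.abs_sub_le hα0 (hdist z x hx)
    rw [Finset.sum_sub_distrib, Finset.sum_const, nsmul_eq_mul, Finset.offDiag_card,
      hlogδ, ← hn, ← hS, ← hΓ] at h1
    rw [Nat.cast_sub (Nat.le_mul_self _), Nat.cast_mul, ← hn] at h1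
    have h2 : constA α g F = -(1 / (n * (n - 1))) * (S - 2 * (n - 1) * Γ) +
        (2 * K * max 1 L + (2 + τ) * L) / n := by
      rw [constA, sum_hsiaKernel]
    -- The maximum with 1 matters only for n = 2, where log n < 1.
    have h3 : K * ε ^ α ≤ K * max 1 L / n := by
      calc K * ε ^ α ≤ K * (1 / n) := by gcongr
        _ ≤ K * (max 1 L / n) := by
            gcongr
            exact le_max_left _ _
        _ = _ := by ring
    have hn1 : n - 1 ≠ 0 := by linarith
    have h4 : -(1 / (n * (n - 1))) * (S - 2 * (n - 1) * Γ) = 2 * (n⁻¹ * Γ) - 1 / (n * (n - 1)) * S := by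
      field_simp; ring
    -- The energy carries 1/n² but A carries 1/(n(n - 1)); the change is in the right direction
    -- because all logarithms of distances are nonpositive.
    have h5 : 1 / (n * (n - 1)) * S ≤ n⁻¹ ^ 2 * S := by
      refine mul_le_mul_of_nonpos_right ?_ hS0
      rw [inv_pow, ← one_div]
      exact one_div_le_one_div_of_le (by nlinarith) (by nlinarith)
    have h6 : n⁻¹ ^ 2 * (S - (n * n - n) * δ + n * (-(τ * L) - Real.log 2)) =
        n⁻¹ ^ 2 * S - δ + δ / n - (τ * L + Real.log 2) / n := by
      field_simp; ring
    -- The errors of order δ add up to less than 2δ, and 2δn ≤ 1/4 < log 2 ≤ log n. Together with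
    -- log 2 ≤ log n from the self-energies, this accounts for the constant 2 in 2 + max(2, 1/α).
    have h7 : 2 * δ ≤ L / n := by
      rw [le_div_iff₀ hn0]
      linarith [Real.log_two_gt_d9]
    have h8 : 0 ≤ δ / n := by positivity
    have h9 : (τ * L + Real.log 2) / n ≤ (τ * L + L) / n := by gcongr
    have h10 : (2 * K * max 1 L + (2 + τ) * L) / n =
        2 * (K * max 1 L / n) + (τ * L + L) / n + L / n := by ring
    rw [h6] at h1
    rw [h2, h4, h10]
    linarith
  have := isFiniteMeasure_regEmpirical hδ hδ1 hFne
  obtain ⟨M, hM⟩ := exists_abs_le_of_continuous hφ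
  obtain ⟨M', hM'⟩ := exists_abs_le_of_continuous hhc
  have hgrad : HasL2Gradient (φ ∘ chartZero) := hφW.2.1
  have hw : MemLp (weakGradient (φ ∘ chartZero)) 2 ∧
      IsWeakGradient (φ ∘ chartZero) (weakGradient (φ ∘ chartZero)) := by
    rw [weakGradient, dif_pos hgrad]
    exact hgrad.choose_spec
  have hμ0 := (hg.1.isChordPotential.log_potential OnePoint.infty).1
  have hν0 := regEmpirical_singleton (F := F) hδ hδ1 OnePoint.infty
  obtain ⟨hE0, hest⟩ := energy_estimate (isPoissonSolution_regEmpirical hδ hδ1 hFne hg.1)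
    (uniformContinuous_comp_chartZero hhc) (hφ.comp OnePoint.continuous_coe) hw.2 hw.1
    (fun z => hM (chartZero z)) (fun z => hM' (chartZero z)) rfl
  have eμ := integral_planeMeasure hμ0 φ
  have eν := integral_planeMeasure hν0 φ
  have eμ' := integral_planeMeasure hμ0 h
  have eν' := integral_planeMeasure hν0 h
  change 0 ≤ (∫ z, h (chartZero z) ∂_) - ∫ z, h (chartZero z) ∂_ at hE0
  change |(∫ z, φ (chartZero z) ∂_) - ∫ z, φ (chartZero z) ∂_| ≤
    √((∫ z, h (chartZero z) ∂_) - ∫ z, h (chartZero z) ∂_) * gradNorm φ at hest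
  rw [eμ', eν', ← hE] at hE0 hest
  rw [eμ, eν] at hest
  refine ⟨hE0.trans hEle, ?_⟩
  -- The smoothed mass at z is carried by points within distance ε of z, so smoothing changes the
  -- average of φ by at most its modulus at ε.
  have hmod : |∫ x, φ x ∂(regEmpirical δ F) - 1 / n * ∑ z ∈ F, φ z| ≤ modulus φ ε := by
    rw [integral_regEmpirical hδ hδ1 hφ, one_div, ← mul_sub, ← Finset.sum_sub_distrib, abs_mul,
      abs_of_pos (inv_pos.2 hn0)]
    have h1 : |∑ z ∈ F, (∫ x, φ x ∂(regDirac δ z) - φ z)| ≤ ∑ _z ∈ F, modulus φ ε :=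
      (Finset.abs_sum_le_sum_abs _ _).trans (Finset.sum_le_sum fun z _ =>
        abs_integral_regDirac_sub_le hδ hδ1 hφ fun x hx => abs_sub_le_modulus hφ (hdist z x hx))
    rw [Finset.sum_const, nsmul_eq_mul] at h1
    calc _ ≤ n⁻¹ * (n * modulus φ ε) := by gcongr
      _ = _ := by field_simp
  have hsqrt : √E * gradNorm φ ≤ constA α g F ^ (1 / 2 : ℝ) * gradNorm φ := by
    rw [← Real.sqrt_eq_rpow]
    exact mul_le_mul_of_nonneg_right (Real.sqrt_le_sqrt hEle) (Real.sqrt_nonneg _)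
  have a1 := abs_le.1 hest
  have a2 := abs_le.1 hmod
  rw [abs_le]; constructor <;> linarith

end RiemannSphere

end

theorem mainTheorem5 (α : ℝ) (hα0 : 0 < α) (hα1 : α ≤ 1)
    (μ : MeasureTheory.Measure RiemannSphere.P1) [MeasureTheory.IsProbabilityMeasure μ]
    (g : RiemannSphere.P1 → ℝ) (hg : RiemannSphere.IsGoodPotential μ g)
    (hgα : RiemannSphere.IsHolder α g)
    (φ : RiemannSphere.P1 → ℝ) (hφ : Continuous φ) (hφW : RiemannSphere.MemW12 φ)
    (F : Finset RiemannSphere.P1) (hF : 2 ≤ F.card) :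
    0 ≤ RiemannSphere.constA α g F ∧
      |∫ x, φ x ∂μ - (1 / (F.card : ℝ)) * ∑ z ∈ F, φ z| ≤
        RiemannSphere.modulus φ (1 / (F.card : ℝ) ^ max 2 (1 / α)) +
          RiemannSphere.constA α g F ^ (1 / 2 : ℝ) * RiemannSphere.gradNorm φ :=
  hgα.equidistribution_estimate hα0 hg hφ hφW hF
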